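/- Let $0\le\alpha\le 2$. A (bipartite quantum) realization consists of complex Hilbert spaces $H_A,H_B$ of arbitrary, possibly infinite, dimension, a unit vector $|\psi'\rangle\in H_A\otimes H_B$, dichotomic observables $A_0,A_1$ on $H_A$ and dichotomic observables $B_0,B_1$ on $H_B$, where a dichotomic observable is an operator that is both unitary and Hermitian. Its Bell value is $$\langle\psi'|\,\alpha A_0+A_0(B_0+B_1)+A_1(B_0-B_1)\,|\psi'\rangle .$$ The maximum of the Bell value over all realizations is $b(\alpha)=\sqrt{8+2\alpha^2}$, and it is attained by a realization on two qubits. Let $|\psi_\theta\rangle=\cos\theta\,|00\rangle+\sin\theta\,|11\rangle\in\mathbb C^2\otimes\mathbb C^2$, where $\theta\in[0,\pi/4]$ is given by $\tan 2\theta=\sqrt{\frac{4-\alpha^2}{2\alpha^2}}$ (with $\theta=\pi/4$ if $\alpha=0$). (Self-testing.) For every realization with Bell value $b(\alpha)$ there are linear isometries $\Phi_A:H_A\to H_A\otimes\mathbb C^2$ and $\Phi_B:H_B\to H_B\otimes\mathbb C^2$ and a unit vector $|\mathrm{junk}\rangle\in H_A\otimes H_B$ such that, after reordering the tensor factors, $$(\Phi_A\otimes\Phi_B)|\psi'\rangle=|\mathrm{junk}\rangle\otimes|\psi_\theta\rangle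 .$$ (Robustness.) There is a constant $C$, depending only on $\alpha$, such that for every $\varepsilon\ge 0$ and every realization with Bell value at least $b(\alpha)-\varepsilon^2$ there are linear isometries $\Phi_A:H_A\to H_A\otimes\mathbb C^2$ and $\Phi_B:H_B\to H_B\otimes\mathbb C^2$ and a unit vector $|\mathrm{junk}\rangle\in H_A\otimes H_B$ with $$\big\|(\Phi_A\otimes\Phi_B)|\psi'\rangle-|\mathrm{junk}\rangle\otimes|\psi_\theta\rangle\big\|\le C\,\varepsilon .$$ -/

import Mathlib

open scoped TensorProduct

universe u v w z

noncomputable section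

namespace TiltedCHSH

/-- The Hilbert space tensor product: the completion of the algebraic tensor product of two
Hilbert spaces for the inner product with `⟪x ⊗ y, x' ⊗ y'⟫ = ⟪x, x'⟫ * ⟪y, y'⟫`. -/
abbrev HilbertTensor (E : Type u) (F : Type v)
    [NormedAddCommGroup E] [InnerProductSpace ℂ E]
    [NormedAddCommGroup F] [InnerProductSpace ℂ F] : Type (max u v) :=
  UniformSpace.Completion (E ⊗[ℂ] F)

section LocalMaps

variable {E : Type u} {F : Type v} {G : Type w} {H : Type z}
  [NormedAddCommGroup E] [InnerProductSpace ℂ E]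
  [NormedAddCommGroup F] [InnerProductSpace ℂ F]
  [NormedAddCommGroup G] [InnerProductSpace ℂ G]
  [NormedAddCommGroup H] [InnerProductSpace ℂ H]

/-- The elementary tensor `x ⊗ y` as a vector of the Hilbert space tensor product. -/
def elemTensor (x : E) (y : F) : HilbertTensor E F := ((x ⊗ₜ[ℂ] y : E ⊗[ℂ] F) : HilbertTensor E F)

/-- The tensor product `f ⊗ g` of two isometries (in particular of two unitaries), acting
between the Hilbert space tensor products. -/
def tensorIsometry (f : E →ₗᵢ[ℂ] G) (g : F →ₗᵢ[ℂ] H) :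
    HilbertTensor E F →ₗᵢ[ℂ] HilbertTensor G H where
  toLinearMap :=
    ((TensorProduct.mapIsometry f g).toContinuousLinearMap.completion).toLinearMap
  norm_map' x := by
    refine UniformSpace.Completion.induction_on x
      (isClosed_eq ?_ continuous_norm) fun a => ?_
    · exact continuous_norm.comp
        ((TensorProduct.mapIsometry f g).toContinuousLinearMap.completion).continuous
    · change ‖(TensorProduct.mapIsometry f g).toContinuousLinearMap.completion
        (a : HilbertTensor E F)‖ = _
      rw [ContinuousLinearMap.completion_apply_coe]
      simp

theorem tensorIsometry_elemTensor (f : E →ₗᵢ[ℂ] G) (g : F →ₗᵢ[ℂ] H) (x : E) (y : F) :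
    tensorIsometry f g (elemTensor x y) = elemTensor (f x) (g y) := by
  change (TensorProduct.mapIsometry f g).toContinuousLinearMap.completion
        ((x ⊗ₜ[ℂ] y : E ⊗[ℂ] F) : HilbertTensor E F) = _
  rw [ContinuousLinearMap.completion_apply_coe]
  simp [elemTensor]

end LocalMaps

/-- The Hilbert space `ℂ²` of one qubit. -/
abbrev Qubit : Type := EuclideanSpace ℂ (Fin 2)

/-- The computational basis vectors `|0⟩` and `|1⟩`. -/
def ket (i : Fin 2) : Qubit := EuclideanSpace.single i 1

/-- A state of two qubits, given by its coefficients in the basis `|ij⟩ = |i⟩ ⊗ |j⟩`. -/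
abbrev TwoQubit : Type := EuclideanSpace ℂ (Fin 2 × Fin 2)

/-- The state `cos θ |00⟩ + sin θ |11⟩`. -/
def entangledState (θ : ℝ) : TwoQubit :=
  (Real.cos θ : ℂ) • EuclideanSpace.single (0, 0) 1 +
    (Real.sin θ : ℂ) • EuclideanSpace.single (1, 1) 1

/-- The isometry `x ↦ x ⊗ |i⟩`, from `H` to `H ⊗ ℂ²`. -/
def appendKet (H : Type u) [NormedAddCommGroup H] [InnerProductSpace ℂ H] (i : Fin 2) :
    H →ₗᵢ[ℂ] H ⊗[ℂ] Qubit where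
  toLinearMap := (TensorProduct.mk ℂ H Qubit).flip (ket i)
  norm_map' x := by simp [ket]

section JunkTensor

variable {HA : Type u} {HB : Type v}
  [NormedAddCommGroup HA] [InnerProductSpace ℂ HA]
  [NormedAddCommGroup HB] [InnerProductSpace ℂ HB]

/-- The vector `junk ⊗ χ`, where `χ = ∑ χᵢⱼ |ij⟩` is a state of two qubits, the first of
which is held by the first party and the second by the second party. The tensor factors are
ordered accordingly: `(x ⊗ y) ⊗ |ij⟩` is read as `(x ⊗ |i⟩) ⊗ (y ⊗ |j⟩)`. -/
def junkTensor (junk : HilbertTensor HA HB) (χ : TwoQubit) :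
    HilbertTensor (HA ⊗[ℂ] Qubit) (HB ⊗[ℂ] Qubit) :=
  ∑ i : Fin 2, ∑ j : Fin 2, χ (i, j) • tensorIsometry (appendKet HA i) (appendKet HB j) junk

theorem junkTensor_elemTensor (x : HA) (y : HB) (χ : TwoQubit) :
    junkTensor (elemTensor x y) χ =
      ∑ i : Fin 2, ∑ j : Fin 2, χ (i, j) • elemTensor (x ⊗ₜ[ℂ] ket i) (y ⊗ₜ[ℂ] ket j) := by
  simp only [junkTensor, tensorIsometry_elemTensor]
  rfl

end JunkTensor

/-- A dichotomic observable: an operator that is unitary and Hermitian, so that its outcomes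
are `1` and `-1`. -/
structure DichotomicObservable (H : Type u) [NormedAddCommGroup H] [InnerProductSpace ℂ H] where
  toUnitary : H ≃ₗᵢ[ℂ] H
  hermitian : ∀ x y : H, inner ℂ (toUnitary x) y = inner ℂ x (toUnitary y)

/-- A bipartite quantum realization with two dichotomic observables `A 0`, `A 1` for the first
party, two dichotomic observables `B 0`, `B 1` for the second party and a pure shared state. -/
structure BellRealization (HA : Type u) (HB : Type v)
    [NormedAddCommGroup HA] [InnerProductSpace ℂ HA]
    [NormedAddCommGroup HB] [InnerProductSpace ℂ HB] where
  state : HilbertTensor HA HB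
  norm_state : ‖state‖ = 1
  A : Fin 2 → DichotomicObservable HA
  B : Fin 2 → DichotomicObservable HB

namespace BellRealization

variable {HA : Type u} {HB : Type v}
  [NormedAddCommGroup HA] [InnerProductSpace ℂ HA]
  [NormedAddCommGroup HB] [InnerProductSpace ℂ HB]

/-- The operator `A x ⊗ 1`. -/
def opA (R : BellRealization HA HB) (x : Fin 2) : HilbertTensor HA HB →L[ℂ] HilbertTensor HA HB :=
  (tensorIsometry (R.A x).toUnitary.toLinearIsometry LinearIsometry.id).toContinuousLinearMap

/-- The operator `1 ⊗ B y`. -/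
def opB (R : BellRealization HA HB) (y : Fin 2) : HilbertTensor HA HB →L[ℂ] HilbertTensor HA HB :=
  (tensorIsometry LinearIsometry.id (R.B y).toUnitary.toLinearIsometry).toContinuousLinearMap

/-- The Bell operator `α A₀ + A₀ (B₀ + B₁) + A₁ (B₀ - B₁)`. -/
def bellOperator (R : BellRealization HA HB) (α : ℝ) :
    HilbertTensor HA HB →L[ℂ] HilbertTensor HA HB :=
  (α : ℂ) • R.opA 0 + R.opA 0 * (R.opB 0 + R.opB 1) + R.opA 1 * (R.opB 0 - R.opB 1)

/-- The value of the Bell expression: the expectation of the (Hermitian) Bell operator. -/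
def value (R : BellRealization HA HB) (α : ℝ) : ℝ :=
  (inner ℂ R.state (R.bellOperator α R.state)).re

end BellRealization

/-- The maximal quantum value `√(8 + 2 α²)`. -/
def maxValue (α : ℝ) : ℝ := √(8 + 2 * α ^ 2)

/-- The angle `θ ∈ [0, π/4]` with `tan (2 θ) = √((4 - α²) / (2 α²))`, the right-hand side being
read as infinite, and hence `θ` as `π/4`, at `α = 0`. -/
def angle (α : ℝ) : ℝ :=
  if α = 0 then Real.pi / 4 else Real.arctan (√((4 - α ^ 2) / (2 * α ^ 2))) / 2

theorem tan_two_mul_angle {α : ℝ} (hα : α ≠ 0) :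
    Real.tan (2 * angle α) = √((4 - α ^ 2) / (2 * α ^ 2)) := by
  rw [angle, if_neg hα, mul_div_cancel₀ _ two_ne_zero, Real.tan_arctan]

end TiltedCHSH

end

open scoped TensorProduct

noncomputable section

namespace TiltedCHSH

/-! ### Algebra of an optimal state -/

section Algebra

variable {V : Type*} [AddCommGroup V] [Module ℂ V]

/-! Let W be the Bell operator, N its companion `coBell` and b the maximal value. Then W² + N² = b²,
which bounds the value by b. For a unit vector ψ it also gives ‖Wψ - bψ‖² + ‖Nψ‖² = 2b(b - ⟨W⟩), so
a value within ε² of b makes Wψ = bψ and Nψ = 0 hold up to O(ε).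

From the exact equations, `relations` and `ideal_action` recover the ideal action of all four
observables on the span of ψ, A₀ψ, y and A₀y, where y plays the role of Xψ for the second party.
Kraus operators are then chosen for each party so that they define isometries for every realization,
and so that on such a ψ the components 01 and 10 vanish while 00 and 11 are in the ratio c : s
(`krausB_apply`). For the second party this needs the inverse of 1 - tX, where X is half the
anticommutator of B₀ and B₁ and t = m² - n² is its eigenvalue at ψ; the inverse exists since ‖X‖ ≤ 1
and |t| < 1.

Robustness comes from the same algebra. The exact argument uses neither norm nor inner product, so
it applies in the space of families of vectors modulo families of size O(ε), on which uniformly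
bounded operators act. Taking all near-optimal realizations as the index set
(`exists_uniform_bound`) gives one constant for all of them, at a linear rate. `exists_junk` turns
the component estimates into closeness to a product, and exact self-testing is the case ε = 0. At α
= 2 the target is a product state, which is treated directly. -/

/-- Two pairs of involutions, each operator of the first pair commuting with each operator of
the second. -/
structure CommutingInvolutions (A B : Fin 2 → Module.End ℂ V) : Prop where
  invol_left : ∀ i v, A i (A i v) = v
  invol_right : ∀ i v, B i (B i v) = v
  comm : ∀ i j v, B j (A i v) = A i (B j v)

/-- The tilted CHSH operator of two pairs of operators. -/
def bell (α : ℝ) (A B : Fin 2 → Module.End ℂ V) (v : V) : V :=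
  (α : ℂ) • A 0 v + A 0 (B 0 v + B 1 v) + A 1 (B 0 v - B 1 v)

/-- The operator `N` for which `N ^ 2` complements the square of the tilted CHSH operator to
the square of the maximal quantum value. -/
def coBell (α : ℝ) (A B : Fin 2 → Module.End ℂ V) (v : V) : V :=
  (α : ℂ) • A 1 v - A 1 (B 0 v + B 1 v) - A 0 (B 0 v - B 1 v)

variable {A B : Fin 2 → Module.End ℂ V}

theorem CommutingInvolutions.bell_bell_add (h : CommutingInvolutions A B) (α : ℝ) (v : V) :
    bell α A B (bell α A B v) + coBell α A B (coBell α A B v) = (8 + 2 * α ^ 2 : ℂ) • v := by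
  simp only [bell, coBell, map_add, map_sub, map_smul, h.comm, h.invol_left, h.invol_right]
  module

variable {α b : ℝ} {ψ : V}

/-- Everything follows by applying operators to the two equations and combining linearly. The only
divisions that depend on α are by 4 - α². Positivity is never used, so that the result also holds
modulo O(ε). -/
theorem CommutingInvolutions.relations (h : CommutingInvolutions A B) (hb : b ^ 2 = 8 + 2 * α ^ 2)
    (hα : α ^ 2 < 4) (h1 : bell α A B ψ = (b : ℂ) • ψ) (h2 : coBell α A B ψ = 0) :
    A 0 (A 1 ψ) + A 1 (A 0 ψ) = 0 ∧ B 0 (B 1 ψ) + B 1 (B 0 ψ) = ((α : ℂ) ^ 2 / 2) • ψ ∧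
      B 0 ψ + B 1 ψ = ((b : ℂ) / 2) • A 0 ψ ∧
      A 1 (B 0 ψ - B 1 ψ) = ((b : ℂ) / 2) • ψ - (α : ℂ) • A 0 ψ := by
  have hbC : (b : ℂ) ^ 2 = 8 + 2 * (α : ℂ) ^ 2 := by exact_mod_cast hb
  have hαC : (4 - (α : ℂ) ^ 2) ≠ 0 := by
    have : (4 - α ^ 2) ≠ 0 := by linarith
    exact_mod_cast this
  unfold bell at h1
  unfold coBell at h2
  obtain ⟨S, hS⟩ : ∃ S, S = B 0 + B 1 := ⟨_, rfl⟩
  obtain ⟨T, hT⟩ : ∃ T, T = B 0 - B 1 := ⟨_, rfl⟩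
  obtain ⟨D, hD⟩ : ∃ D, D = B 0 * B 1 + B 1 * B 0 := ⟨_, rfl⟩
  obtain ⟨a, ha⟩ : ∃ a, a = A 0 * A 1 + A 1 * A 0 := ⟨_, rfl⟩
  obtain ⟨K, hK⟩ : ∃ K, K = A 0 * A 1 - A 1 * A 0 := ⟨_, rfl⟩
  have e8 : (2 : ℂ) • S ψ + a (T ψ) = (b : ℂ) • A 0 ψ := by
    have e := congrArg (A 0) h1
    have f := congrArg (A 1) h2
    simp only [hS, hT, ha, map_add, map_sub, map_smul, map_zero, h.invol_left,
      LinearMap.add_apply, LinearMap.sub_apply, Module.End.mul_apply] at e f ⊢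
    linear_combination (norm := module) e - f
  have e5 : K (T ψ) = (b : ℂ) • A 0 ψ - (2 * α : ℂ) • ψ := by
    have e := congrArg (A 0) h1
    have f := congrArg (A 1) h2
    simp only [hK, hT, map_add, map_sub, map_smul, map_zero, h.invol_left,
      LinearMap.sub_apply, Module.End.mul_apply] at e f ⊢
    linear_combination (norm := module) e + f
  have e7 : K (S ψ) = (α : ℂ) • a ψ - (b : ℂ) • A 1 ψ := by
    have e := congrArg (A 1) h1
    have f := congrArg (A 0) h2
    simp only [hK, hS, ha, map_add, map_sub, map_smul, map_zero, h.invol_left,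
      LinearMap.add_apply, LinearMap.sub_apply, Module.End.mul_apply] at e f ⊢
    linear_combination (norm := module) -e - f
  -- `e8` iterated: (2S + aT)²ψ = b²ψ, because `a` commutes with `A 0`. Here S² = 2 + D, T² = 2 - D
  -- and ST + TS = 0.
  have e10 : (4 : ℂ) • D ψ + (2 : ℂ) • a (a ψ) - D (a (a ψ)) = (2 * (α : ℂ) ^ 2) • ψ := by
    have e := congrArg (A 0) e8
    have f := congrArg ((2 : ℂ) • S + a * T) e8
    simp only [hS, hT, hD, ha, map_add, map_sub, map_smul, h.comm, h.invol_left,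
      h.invol_right, LinearMap.add_apply, LinearMap.sub_apply, LinearMap.smul_apply,
      Module.End.mul_apply] at e f ⊢
    linear_combination (norm := module) (b : ℂ) • e + f + hbC • ψ
  -- `e7` iterated: (KS + b A₁)²ψ = α²a²ψ, where K² = a² - 4 and K anticommutes with A₁. Adding
  -- `e10` eliminates D.
  have e11 : (4 - (α : ℂ) ^ 2) • a (a ψ) = 0 := by
    have e := congrArg (K * S + (b : ℂ) • A 1) e7
    have f := congrArg ((α : ℂ) • a) e7
    simp only [hS, hD, hK, ha, map_add, map_sub, map_smul, h.comm, h.invol_left,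
      h.invol_right, LinearMap.add_apply, LinearMap.sub_apply, LinearMap.smul_apply,
      Module.End.mul_apply] at e f e10 ⊢
    linear_combination (norm := module) e + f + e10 - hbC • ψ
  -- Self-adjointness of `a` would now give aψ = 0, but in the approximate setting only to order √ε;
  -- more algebra preserves the linear rate.
  have haa : a (a ψ) = 0 := (smul_eq_zero.mp e11).resolve_left hαC
  have hDψ : D ψ = ((α : ℂ) ^ 2 / 2) • ψ := by
    rw [haa] at e10
    simp only [map_zero] at e10
    linear_combination (norm := module) (1 / 4 : ℂ) • e10
  have e12 : a (T ((α : ℂ) • ψ - S ψ)) = 0 := by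
    have e := congrArg T e7
    have f := congrArg S e5
    have g := congrArg S e8
    simp only [hS, hT, hD, hK, ha, map_add, map_sub, map_smul, h.comm,
      h.invol_right, LinearMap.add_apply, LinearMap.sub_apply,
      Module.End.mul_apply] at e f g e8 hDψ h1 ⊢
    linear_combination (norm := module) (1 / 2 : ℂ) • ((b : ℂ) • h1 - e - f + (α : ℂ) • e8 +
      (2 : ℂ) • g - (4 : ℂ) • hDψ + hbC • ψ)
  -- Apply α - S to `e12`: since S anticommutes with T, the result is aT(α² - S²)ψ, a multiple of
  -- aTψ by `hDψ`.
  have haT : a (T ψ) = 0 := by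
    refine (smul_eq_zero.mp (?_ : (4 - (α : ℂ) ^ 2) • a (T ψ) = 0)).resolve_left hαC
    have e := congrArg ((α : ℂ) • 1 - S : Module.End ℂ V) e12
    have f := congrArg (a * T) hDψ
    simp only [hS, hT, hD, ha, map_add, map_sub, map_smul, map_zero, h.comm,
      h.invol_right, LinearMap.add_apply, LinearMap.sub_apply, LinearMap.smul_apply,
      Module.End.mul_apply, Module.End.one_apply] at e f ⊢
    linear_combination (norm := module) (-2 : ℂ) • e - (2 : ℂ) • f
  -- T² = 2 - D acts on ψ as the nonzero scalar 2 - α²/2.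
  have haψ : a ψ = 0 := by
    refine (smul_eq_zero.mp (?_ : (4 - (α : ℂ) ^ 2) • a ψ = 0)).resolve_left hαC
    have e := congrArg T haT
    have f := congrArg a hDψ
    simp only [hT, hD, ha, map_add, map_sub, map_smul, map_zero, h.comm,
      h.invol_right, LinearMap.add_apply, LinearMap.sub_apply,
      Module.End.mul_apply] at e f ⊢
    linear_combination (norm := module) (2 : ℂ) • e + (2 : ℂ) • f
  have hAS : B 0 ψ + B 1 ψ = ((b : ℂ) / 2) • A 0 ψ := by
    rw [haT] at e8
    simp only [hS, LinearMap.add_apply] at e8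
    linear_combination (norm := module) (1 / 2 : ℂ) • e8
  refine ⟨by simpa [ha] using haψ, by simpa [hD] using hDψ, hAS, ?_⟩
  have e := congrArg (A 0) hAS
  simp only [map_add, map_smul, h.invol_left] at e h1
  linear_combination (norm := module) h1 - e

end Algebra

/-- The scalars of the ideal realization: `α / 2 = m cos 2θ` and `n = m sin 2θ`, where
`c = cos θ` and `s = sin θ`, while `m = cos μ` and `n = sin μ` for half the angle `μ` between the
observables of the second party, and `k = cos (μ / 2)` and `l = sin (μ / 2)`. -/
structure IdealScalars (α c s m n k l : ℝ) : Prop where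
  cs : c ^ 2 + s ^ 2 = 1
  kl : k ^ 2 + l ^ 2 = 1
  hm : m = k ^ 2 - l ^ 2
  hn : n = 2 * k * l
  hα : α = 2 * m * (c ^ 2 - s ^ 2)
  hmn : n = 2 * m * c * s
  m_pos : 0 < m
  n_nonneg : 0 ≤ n
  bound : 16 * m ^ 2 = 8 + 2 * α ^ 2

/-! ### Kraus operators and their action on an optimal state -/

section Kraus

variable {𝓐 : Type*} [Ring 𝓐] [Algebra ℂ 𝓐]

/-- The Kraus operators of the first party. -/
def krausA (A : Fin 2 → 𝓐) : Fin 2 → 𝓐 :=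
  ![(1 / 2 : ℂ) • (1 + A 0), (1 / 2 : ℂ) • (A 1 * (1 - A 0))]

/-- Half the anticommutator. -/
def halfAnti (B : Fin 2 → 𝓐) : 𝓐 := (1 / 2 : ℂ) • (B 0 * B 1 + B 1 * B 0)

/-- The Kraus operators of the second party, in the frame in which `B 0` is diagonal. The element
`R` stands for the inverse of `1 - (m² - n²) X`, where `X` is half the anticommutator of `B 0` and
`B 1`. -/
def krausB' (m n : ℝ) (B : Fin 2 → 𝓐) (R : 𝓐) : Fin 2 → 𝓐 :=
  ![(1 / 2 : ℂ) • (1 + B 0) +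
      (1 / 2 : ℂ) • ((halfAnti B - (m ^ 2 - n ^ 2 : ℂ) • 1) * (R * (1 - B 0))),
    -(m * n / 2 : ℂ) • (R * ((1 + B 0) * (B 1 * (1 - B 0))))]

/-- The Kraus operators of the second party. -/
def krausB (m n k l : ℝ) (B : Fin 2 → 𝓐) (R : 𝓐) : Fin 2 → 𝓐 :=
  ![(k : ℂ) • krausB' m n B R 0 - (l : ℂ) • krausB' m n B R 1,
    (l : ℂ) • krausB' m n B R 0 + (k : ℂ) • krausB' m n B R 1]

variable {𝓑 : Type*} [Ring 𝓑] [Algebra ℂ 𝓑]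

theorem map_krausA (f : 𝓐 →ₐ[ℂ] 𝓑) (A : Fin 2 → 𝓐) (i : Fin 2) :
    f (krausA A i) = krausA (fun j => f (A j)) i := by
  fin_cases i <;> simp [krausA, -Complex.coe_smul]

theorem map_krausB (f : 𝓐 →ₐ[ℂ] 𝓑) (m n k l : ℝ) (B : Fin 2 → 𝓐) (R : 𝓐) (i : Fin 2) :
    f (krausB m n k l B R i) = krausB m n k l (fun j => f (B j)) (f R) i := by
  fin_cases i <;> simp [krausB, krausB', halfAnti, -Complex.coe_smul]

end Kraus

section

variable {V : Type*} [AddCommGroup V] [Module ℂ V] {A B : Fin 2 → Module.End ℂ V} {ψ : V}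
  {α c s m n k l : ℝ}

/-- The model is A₀ = Z, A₁ = X, B₀ = mZ + nX and B₁ = mZ - nX, in which Z gives the same vector on
either side of ψ. The formulas close up on the span of ψ, A₀ψ, y and A₀y. -/
theorem CommutingInvolutions.ideal_action (h : CommutingInvolutions A B)
    (p : IdealScalars α c s m n k l) (hn0 : 0 < n)
    (h1 : bell α A B ψ = ((4 * m : ℝ) : ℂ) • ψ)
    (h2 : coBell α A B ψ = 0) :
    ∃ y : V, B 0 ψ = (m : ℂ) • A 0 ψ + (n : ℂ) • y ∧ B 1 ψ = (m : ℂ) • A 0 ψ - (n : ℂ) • y ∧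
      B 0 y = (n : ℂ) • ψ - (m : ℂ) • A 0 y ∧ B 1 y = -(n : ℂ) • ψ - (m : ℂ) • A 0 y ∧
      A 1 ψ = (m / n : ℂ) • y - (α / (2 * n) : ℂ) • A 0 y ∧
      A 1 y = (m / n : ℂ) • ψ - (α / (2 * n) : ℂ) • A 0 ψ ∧
      A 1 (A 0 ψ) = -A 0 (A 1 ψ) ∧ A 1 (A 0 y) = -A 0 (A 1 y) := by
  have hn : (n : ℂ) ≠ 0 := by exact_mod_cast hn0.ne'
  have hα0 : α ^ 2 = 4 * (m ^ 2 - n ^ 2) := by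
    rw [p.hα, p.hmn]
    linear_combination 4 * m ^ 2 * (c ^ 2 + s ^ 2 + 1) * p.cs
  have hmn1 : m ^ 2 + n ^ 2 = 1 := by linear_combination (p.bound + 2 * hα0) / 8
  have hmnC : (m : ℂ) ^ 2 + (n : ℂ) ^ 2 = 1 := by exact_mod_cast hmn1
  have hαC : (α : ℂ) ^ 2 = 4 * ((m : ℂ) ^ 2 - (n : ℂ) ^ 2) := by exact_mod_cast hα0
  obtain ⟨ha, -, hS, hT⟩ := h.relations (b := 4 * m) (by linarith [p.bound])
    (by nlinarith [hn0]) h1 h2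
  have hS' : B 0 ψ + B 1 ψ = (2 * m : ℂ) • A 0 ψ := by
    rw [hS]; push_cast; module
  have hT' : A 1 (B 0 ψ - B 1 ψ) = (2 * m : ℂ) • ψ - (α : ℂ) • A 0 ψ := by
    rw [hT]; push_cast; module
  -- In the model, (B₀ - B₁) / (2n) is the operator X of the second party.
  obtain ⟨y, hy⟩ : ∃ y, y = (1 / (2 * n) : ℂ) • (B 0 ψ - B 1 ψ) := ⟨_, rfl⟩
  have hny : (n : ℂ) • y = (1 / 2 : ℂ) • (B 0 ψ - B 1 ψ) := by
    rw [hy, smul_smul]; congr 1; field_simp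
  have y0 : B 0 ψ = (m : ℂ) • A 0 ψ + (n : ℂ) • y := by
    linear_combination (norm := module) -hny + (1 / 2 : ℂ) • hS'
  have y1 : B 1 ψ = (m : ℂ) • A 0 ψ - (n : ℂ) • y := by
    linear_combination (norm := module) hny + (1 / 2 : ℂ) • hS'
  have cancel : ∀ {u v : V}, (n : ℂ) • u = (n : ℂ) • v → u = v := fun e =>
    smul_right_injective V hn e
  have a1 : A 1 (A 0 ψ) = -A 0 (A 1 ψ) := eq_neg_of_add_eq_zero_right ha
  have a1y : A 1 (A 0 y) = -A 0 (A 1 y) := by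
    have e := congrArg (B 0) a1
    have f := congrArg (B 1) a1
    simp only [map_neg, h.comm] at e f
    rw [hy]
    simp only [map_smul, map_sub]
    linear_combination (norm := module) (1 / (2 * n) : ℂ) • (e - f)
  have b0y : B 0 y = (n : ℂ) • ψ - (m : ℂ) • A 0 y := by
    apply cancel
    have e := h.invol_right 0 ψ
    simp only [map_add, map_smul, h.comm, y0, h.invol_left] at e
    linear_combination (norm := module) e - hmnC • ψ
  have b1y : B 1 y = -(n : ℂ) • ψ - (m : ℂ) • A 0 y := by
    apply cancel
    have e := h.invol_right 1 ψ
    simp only [map_sub, map_smul, h.comm, y1, h.invol_left] at e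
    linear_combination (norm := module) -e + hmnC • ψ
  have hA1y : (n : ℂ) • A 1 y = (m : ℂ) • ψ - (α / 2 : ℂ) • A 0 ψ := by
    have e := congrArg (A 1) hny
    simp only [map_smul] at e
    rw [hT'] at e
    linear_combination (norm := module) e
  have A1y : A 1 y = (m / n : ℂ) • ψ - (α / (2 * n) : ℂ) • A 0 ψ := by
    apply cancel
    rw [hA1y]
    match_scalars <;> field_simp
  -- Inverts m + (α/2)A₀: its product with m - (α/2)A₀ is m² - α²/4 = n².
  have A1ψ : A 1 ψ = (m / n : ℂ) • y - (α / (2 * n) : ℂ) • A 0 y := by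
    have e := congrArg (A 1) hA1y
    simp only [map_sub, map_smul, h.invol_left, a1] at e
    have f := congrArg (A 0) e
    simp only [map_sub, map_smul, map_neg, h.invol_left] at f
    apply cancel
    apply cancel
    have g : (n : ℂ) • (m : ℂ) • y - (n : ℂ) • (α / 2 : ℂ) • A 0 y = (n : ℂ) • (n : ℂ) • A 1 ψ := by
      linear_combination (norm := module) (m : ℂ) • e - (α / 2 : ℂ) • f - (1 / 4 * hαC) • (A 1 ψ)
    rw [← g]
    match_scalars <;> field_simp
  exact ⟨y, y0, y1, b0y, b1y, A1ψ, A1y, a1, a1y⟩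

/-- The Kraus operators of the second party send ψ to (1 + A₀)/2 · (kψ + ly) and (1 - A₀)/2 · (lψ +
ky). The complementary projections of the first party kill the mixed components, and A₁ relates the
other two with factor s / c = (m - α/2) / n. -/
theorem CommutingInvolutions.krausB_apply (h : CommutingInvolutions A B)
    (p : IdealScalars α c s m n k l) (hn0 : 0 < n)
    (h1 : bell α A B ψ = ((4 * m : ℝ) : ℂ) • ψ)
    (h2 : coBell α A B ψ = 0) {R : Module.End ℂ V}
    (hR : R * (1 - (m ^ 2 - n ^ 2 : ℂ) • halfAnti B) = 1) :
    krausA A 0 (krausB m n k l B R 1 ψ) = 0 ∧ krausA A 1 (krausB m n k l B R 0 ψ) = 0 ∧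
      (s : ℂ) • krausA A 0 (krausB m n k l B R 0 ψ) =
        (c : ℂ) • krausA A 1 (krausB m n k l B R 1 ψ) := by
  obtain ⟨y, y0, y1, b0y, b1y, A1ψ, A1y, a1, a1y⟩ := h.ideal_action p hn0 h1 h2
  have hn : (n : ℂ) ≠ 0 := by exact_mod_cast hn0.ne'
  have hm : (m : ℂ) ≠ 0 := by exact_mod_cast p.m_pos.ne'
  have hα0 : α ^ 2 = 4 * (m ^ 2 - n ^ 2) := by
    rw [p.hα, p.hmn]
    linear_combination 4 * m ^ 2 * (c ^ 2 + s ^ 2 + 1) * p.cs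
  have hmn1 : m ^ 2 + n ^ 2 = 1 := by linear_combination (p.bound + 2 * hα0) / 8
  have hmnC : (m : ℂ) ^ 2 + (n : ℂ) ^ 2 = 1 := by exact_mod_cast hmn1
  have hX : ∀ v, halfAnti B v = (1 / 2 : ℂ) • (B 0 (B 1 v) + B 1 (B 0 v)) := fun v => rfl
  -- With m² + n² = 1, the factor is 1 - (m² - n²)² = 4m²n².
  have hR' : ∀ v, halfAnti B v = (m ^ 2 - n ^ 2 : ℂ) • v → (4 * m ^ 2 * n ^ 2 : ℂ) • R v = v := by
    intro v hv
    have e : R (v - (m ^ 2 - n ^ 2 : ℂ) • halfAnti B v) = v := LinearMap.congr_fun hR v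
    rw [hv, map_sub, map_smul, map_smul] at e
    linear_combination (norm := module) e + ((1 + m ^ 2 + n ^ 2 : ℂ) * hmnC) • R v
  have hR'' : ∀ v, halfAnti B v = (m ^ 2 - n ^ 2 : ℂ) • v →
      R v = (1 / (4 * m ^ 2 * n ^ 2) : ℂ) • v := by
    intro v hv
    conv_rhs => rw [← hR' v hv, smul_smul]
    rw [one_div_mul_cancel (by simp [hn, hm]), one_smul]
  have r0 : R (ψ - B 0 ψ) = (1 / (4 * m ^ 2 * n ^ 2) : ℂ) • (ψ - B 0 ψ) := by
    apply hR''
    simp only [hX, map_sub, map_add, map_smul, y0, y1, b0y, b1y, h.comm, h.invol_left]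
    module
  have e1 : B 1 (ψ - B 0 ψ) + B 0 (B 1 (ψ - B 0 ψ)) =
      (4 * m * n : ℂ) • ((n : ℂ) • A 0 ψ - (m : ℂ) • y + A 0 y) := by
    simp only [map_sub, map_add, map_smul, y0, y1, b0y, b1y, h.comm, h.invol_left]
    linear_combination (norm := module) hmnC • ((n : ℂ) • y - (m : ℂ) • A 0 ψ)
  have r1 : R (B 1 (ψ - B 0 ψ) + B 0 (B 1 (ψ - B 0 ψ))) =
      (1 / (m * n) : ℂ) • ((n : ℂ) • A 0 ψ - (m : ℂ) • y + A 0 y) := by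
    rw [hR'', e1]
    · match_scalars <;> field_simp
    · rw [e1]
      simp only [hX, map_sub, map_add, map_smul, y0, y1, b0y, b1y, h.comm, h.invol_left]
      module
  have w0 : krausB' m n B R 0 ψ = (1 / 2 : ℂ) • (ψ + (m : ℂ) • A 0 ψ + (n : ℂ) • y) := by
    have : halfAnti B (R (ψ - B 0 ψ)) - (m ^ 2 - n ^ 2 : ℂ) • R (ψ - B 0 ψ) = 0 := by
      rw [r0]
      simp only [hX, map_sub, map_add, map_smul, y0, y1, b0y, b1y, h.comm, h.invol_left]
      module
    have e : krausB' m n B R 0 ψ = (1 / 2 : ℂ) • (ψ + B 0 ψ) + (1 / 2 : ℂ) •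
      (halfAnti B (R (ψ - B 0 ψ)) - (m ^ 2 - n ^ 2 : ℂ) • R (ψ - B 0 ψ)) := rfl
    rw [e, this, y0]
    module
  have w1 : krausB' m n B R 1 ψ = -(1 / 2 : ℂ) • ((n : ℂ) • A 0 ψ - (m : ℂ) • y + A 0 y) := by
    have e : krausB' m n B R 1 ψ =
      -(m * n / 2 : ℂ) • R (B 1 (ψ - B 0 ψ) + B 0 (B 1 (ψ - B 0 ψ))) := rfl
    rw [e, r1]
    match_scalars <;> field_simp
  have hklC : (k : ℂ) ^ 2 + (l : ℂ) ^ 2 = 1 := by exact_mod_cast p.kl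
  have hmC : (m : ℂ) = (k : ℂ) ^ 2 - (l : ℂ) ^ 2 := by exact_mod_cast p.hm
  have hnC : (n : ℂ) = 2 * (k : ℂ) * (l : ℂ) := by exact_mod_cast p.hn
  have u0 : krausB m n k l B R 0 ψ =
      (1 / 2 : ℂ) • ((k : ℂ) • (ψ + A 0 ψ) + (l : ℂ) • (y + A 0 y)) := by
    have e : krausB m n k l B R 0 ψ =
      (k : ℂ) • krausB' m n B R 0 ψ - (l : ℂ) • krausB' m n B R 1 ψ := rfl
    rw [e, w0, w1]
    have i1 : (k * m + l * n : ℂ) = k := by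
      rw [hmC, hnC]; linear_combination (k : ℂ) * hklC
    have i2 : (k * n - l * m : ℂ) = l := by
      rw [hmC, hnC]; linear_combination (l : ℂ) * hklC
    linear_combination (norm := module) (1 / 2 : ℂ) • (i1 • A 0 ψ + i2 • y)
  have u1 : krausB m n k l B R 1 ψ =
      (1 / 2 : ℂ) • ((l : ℂ) • (ψ - A 0 ψ) + (k : ℂ) • (y - A 0 y)) := by
    have e : krausB m n k l B R 1 ψ =
      (l : ℂ) • krausB' m n B R 0 ψ + (k : ℂ) • krausB' m n B R 1 ψ := rfl
    rw [e, w0, w1]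
    have i1 : (l * m - k * n : ℂ) = -l := by
      rw [hmC, hnC]; linear_combination -(l : ℂ) * hklC
    have i2 : (l * n + k * m : ℂ) = k := by
      rw [hmC, hnC]; linear_combination (k : ℂ) * hklC
    linear_combination (norm := module) (1 / 2 : ℂ) • (i1 • A 0 ψ + i2 • y)
  have v0 : ∀ v, krausA A 0 v = (1 / 2 : ℂ) • (v + A 0 v) := fun v => rfl
  have v1 : ∀ v, krausA A 1 v = (1 / 2 : ℂ) • A 1 (v - A 0 v) := fun v => rfl
  have hα' : (c * (m - α / 2) : ℂ) = s * n := by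
    have : c * (m - α / 2) = s * n := by
      rw [p.hα, p.hmn]; linear_combination (-c * m) * p.cs
    exact_mod_cast this
  have hα'' : (c * (m / n) : ℂ) = s + c * (α / (2 * n)) := by
    field_simp
    linear_combination 2 * hα'
  refine ⟨?_, ?_, ?_⟩
  · rw [v0, u1]
    simp only [map_smul, map_add, map_sub, h.invol_left]
    module
  · rw [v1, u0]
    simp only [map_smul, map_add, map_sub, h.invol_left]
    module
  · rw [v0, v1, u0, u1]
    simp only [map_smul, map_add, map_sub, h.invol_left, a1, a1y, A1ψ, A1y]
    linear_combination (norm := module)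
      -(1 / 2 : ℂ) • hα'' • ((k : ℂ) • (ψ + A 0 ψ) + (l : ℂ) • (y + A 0 y))

end

/-! ### Local operators on the Hilbert tensor product -/

section Lift

variable {E : Type u} {F : Type v} [NormedAddCommGroup E] [InnerProductSpace ℂ E]
  [NormedAddCommGroup F] [InnerProductSpace ℂ F]

theorem continuousLinearMap_ext_elemTensor {G : Type*} [NormedAddCommGroup G] [NormedSpace ℂ G]
    {S T : HilbertTensor E F →L[ℂ] G} (h : ∀ x y, S (elemTensor x y) = T (elemTensor x y)) :
    S = T := by
  ext v
  induction v using UniformSpace.Completion.induction_on with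
  | hp => exact isClosed_eq S.continuous T.continuous
  | ih a =>
    induction a using TensorProduct.induction_on with
    | zero => rw [UniformSpace.Completion.coe_zero, map_zero, map_zero]
    | tmul x y => exact h x y
    | add a b ha hb => rw [UniformSpace.Completion.coe_add, map_add, map_add, ha, hb]

theorem elemTensor_add_left (x x' : E) (y : F) :
    elemTensor (x + x') y = elemTensor x y + elemTensor x' y := by
  rw [elemTensor, TensorProduct.add_tmul, UniformSpace.Completion.coe_add]; rfl

theorem elemTensor_add_right (x : E) (y y' : F) :
    elemTensor x (y + y') = elemTensor x y + elemTensor x y' := by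
  rw [elemTensor, TensorProduct.tmul_add, UniformSpace.Completion.coe_add]; rfl

theorem elemTensor_smul_left (t : ℂ) (x : E) (y : F) :
    elemTensor (t • x) y = t • elemTensor x y := by
  rw [elemTensor, elemTensor, ← UniformSpace.Completion.coe_smul, TensorProduct.smul_tmul']

theorem elemTensor_smul_right (t : ℂ) (x : E) (y : F) :
    elemTensor x (t • y) = t • elemTensor x y := by
  rw [elemTensor, elemTensor, ← UniformSpace.Completion.coe_smul, TensorProduct.tmul_smul]

theorem norm_completion_le (T : E →L[ℂ] E) : ‖T.completion‖ ≤ ‖T‖ := by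
  refine ContinuousLinearMap.opNorm_le_bound _ (norm_nonneg _) fun v => ?_
  induction v using UniformSpace.Completion.induction_on with
  | hp => exact isClosed_le (by fun_prop) (by fun_prop)
  | ih a => simpa using T.le_opNorm a

variable (E F)

/-- The operator `T ⊗ 1`. -/
def liftLeft : (E →L[ℂ] E) →ₐ[ℂ] (HilbertTensor E F →L[ℂ] HilbertTensor E F) :=
  AlgHom.ofLinearMap
    { toFun := fun T => (T.rTensor F).completion
      map_add' := fun S T => continuousLinearMap_ext_elemTensor fun x y => by
        simp [elemTensor, UniformSpace.Completion.coe_add]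
      map_smul' := fun t T => continuousLinearMap_ext_elemTensor fun x y => by
        simp [elemTensor] }
    (continuousLinearMap_ext_elemTensor fun x y => by simp [elemTensor])
    (fun S T => continuousLinearMap_ext_elemTensor fun x y => by simp [elemTensor])

/-- The operator `1 ⊗ T`. -/
def liftRight : (F →L[ℂ] F) →ₐ[ℂ] (HilbertTensor E F →L[ℂ] HilbertTensor E F) :=
  AlgHom.ofLinearMap
    { toFun := fun T => (T.lTensor E).completion
      map_add' := fun S T => continuousLinearMap_ext_elemTensor fun x y => by
        simp [elemTensor, UniformSpace.Completion.coe_add]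
      map_smul' := fun t T => continuousLinearMap_ext_elemTensor fun x y => by
        simp [elemTensor] }
    (continuousLinearMap_ext_elemTensor fun x y => by simp [elemTensor])
    (fun S T => continuousLinearMap_ext_elemTensor fun x y => by simp [elemTensor])

variable {E F}

theorem liftLeft_elemTensor (T : E →L[ℂ] E) (x : E) (y : F) :
    liftLeft E F T (elemTensor x y) = elemTensor (T x) y := by
  change (T.rTensor F).completion (elemTensor x y) = _
  simp [elemTensor]

theorem liftRight_elemTensor (T : F →L[ℂ] F) (x : E) (y : F) :
    liftRight E F T (elemTensor x y) = elemTensor x (T y) := by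
  change (T.lTensor E).completion (elemTensor x y) = _
  simp [elemTensor]

theorem norm_liftRight_le (T : F →L[ℂ] F) : ‖liftRight E F T‖ ≤ ‖T‖ :=
  (norm_completion_le _).trans (ContinuousLinearMap.opNorm_le_bound _ (norm_nonneg _) fun v => by
    rw [← ContinuousLinearMap.commIsometry_comp_lTensor_comp_commIsometry_eq]
    simpa using (T.rTensor E).le_of_opNorm_le (T.norm_rTensor_le E)
      (TensorProduct.commIsometry ℂ E F v))

theorem liftRight_liftLeft_comm (S : E →L[ℂ] E) (T : F →L[ℂ] F) (v : HilbertTensor E F) :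
    liftRight E F T (liftLeft E F S v) = liftLeft E F S (liftRight E F T v) := by
  have : liftRight E F T * liftLeft E F S = liftLeft E F S * liftRight E F T :=
    continuousLinearMap_ext_elemTensor fun x y => by
      simp [liftRight_elemTensor, liftLeft_elemTensor]
  exact DFunLike.congr_fun this v

end Lift

/-! ### Isometries from Kraus operators -/

section KrausIsometry

variable {H : Type u} [NormedAddCommGroup H] [InnerProductSpace ℂ H]

/-- The isometry `x ↦ V₀ x ⊗ |0⟩ + V₁ x ⊗ |1⟩` given by two Kraus operators. -/
def krausIsometry (V : Fin 2 → H →L[ℂ] H) (hV : ∀ x, ‖V 0 x‖ ^ 2 + ‖V 1 x‖ ^ 2 = ‖x‖ ^ 2) :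
    H →ₗᵢ[ℂ] H ⊗[ℂ] Qubit where
  toLinearMap := (appendKet H 0).toLinearMap ∘ₗ (V 0).toLinearMap +
    (appendKet H 1).toLinearMap ∘ₗ (V 1).toLinearMap
  norm_map' x := by
    have h : inner ℂ (appendKet H 0 (V 0 x)) (appendKet H 1 (V 1 x)) = 0 := by
      simp [appendKet, ket, EuclideanSpace.inner_single_left]
    have e := norm_add_sq_eq_norm_sq_add_norm_sq_of_inner_eq_zero (𝕜 := ℂ) (E := H ⊗[ℂ] Qubit) _ _ h
    simp only [LinearIsometry.norm_map, ← pow_two, hV] at e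
    exact (pow_left_inj₀ (norm_nonneg _) (norm_nonneg _) two_ne_zero).mp e

theorem krausIsometry_apply (V : Fin 2 → H →L[ℂ] H)
    (hV : ∀ x, ‖V 0 x‖ ^ 2 + ‖V 1 x‖ ^ 2 = ‖x‖ ^ 2) (x : H) :
    krausIsometry V hV x = appendKet H 0 (V 0 x) + appendKet H 1 (V 1 x) := rfl

variable {F : Type v} [NormedAddCommGroup F] [InnerProductSpace ℂ F]

theorem tensorIsometry_krausIsometry (V : Fin 2 → H →L[ℂ] H)
    (hV : ∀ x, ‖V 0 x‖ ^ 2 + ‖V 1 x‖ ^ 2 = ‖x‖ ^ 2) (W : Fin 2 → F →L[ℂ] F)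
    (hW : ∀ x, ‖W 0 x‖ ^ 2 + ‖W 1 x‖ ^ 2 = ‖x‖ ^ 2) (v : HilbertTensor H F) :
    tensorIsometry (krausIsometry V hV) (krausIsometry W hW) v =
      ∑ i : Fin 2, ∑ j : Fin 2, tensorIsometry (appendKet H i) (appendKet F j)
        (liftLeft H F (V i) (liftRight H F (W j) v)) := by
  have : (tensorIsometry (krausIsometry V hV) (krausIsometry W hW)).toContinuousLinearMap =
      ∑ i : Fin 2, ∑ j : Fin 2,
        (tensorIsometry (appendKet H i) (appendKet F j)).toContinuousLinearMap.comp
          ((liftLeft H F (V i)).comp (liftRight H F (W j))) :=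
    continuousLinearMap_ext_elemTensor fun x y => by
      simp only [Fin.sum_univ_two, add_apply,
        ContinuousLinearMap.comp_apply, LinearIsometry.coe_toContinuousLinearMap, liftRight_elemTensor, liftLeft_elemTensor,
        tensorIsometry_elemTensor, krausIsometry_apply, elemTensor_add_left, elemTensor_add_right]
      abel
  have e := DFunLike.congr_fun this v
  simpa only [Fin.sum_univ_two, add_apply,
        ContinuousLinearMap.comp_apply, LinearIsometry.coe_toContinuousLinearMap] using e

end KrausIsometry

section Observable

variable {H : Type u} [NormedAddCommGroup H] [InnerProductSpace ℂ H]

/-- A dichotomic observable as a bounded operator. -/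
def DichotomicObservable.op (A : DichotomicObservable H) : H →L[ℂ] H :=
  A.toUnitary.toLinearIsometry.toContinuousLinearMap

theorem DichotomicObservable.norm_op (A : DichotomicObservable H) (x : H) : ‖A.op x‖ = ‖x‖ :=
  A.toUnitary.norm_map x

theorem DichotomicObservable.inner_op (A : DichotomicObservable H) (x y : H) :
    inner ℂ (A.op x) y = inner ℂ x (A.op y) := A.hermitian x y

theorem DichotomicObservable.op_op (A : DichotomicObservable H) (x : H) : A.op (A.op x) = x :=
  ext_inner_right ℂ fun y => by rw [A.inner_op]; exact A.toUnitary.inner_map_map x y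

theorem DichotomicObservable.op_mul_op (A : DichotomicObservable H) : A.op * A.op = 1 :=
  ContinuousLinearMap.ext A.op_op

theorem DichotomicObservable.norm_add_sub (A : DichotomicObservable H) (x : H) :
    ‖x + A.op x‖ ^ 2 + ‖x - A.op x‖ ^ 2 = 4 * ‖x‖ ^ 2 := by
  have := parallelogram_law_with_norm ℂ x (A.op x)
  rw [A.norm_op] at this
  linarith

theorem norm_krausA (A : Fin 2 → DichotomicObservable H) (x : H) :
    ‖krausA (fun i => (A i).op) 0 x‖ ^ 2 + ‖krausA (fun i => (A i).op) 1 x‖ ^ 2 = ‖x‖ ^ 2 := by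
  have e0 : krausA (fun i => (A i).op) 0 x = (1 / 2 : ℂ) • (x + (A 0).op x) := rfl
  have e1 : krausA (fun i => (A i).op) 1 x = (1 / 2 : ℂ) • (A 1).op (x - (A 0).op x) := rfl
  rw [e0, e1, norm_smul, norm_smul, (A 1).norm_op, mul_pow, mul_pow, ← mul_add,
    (A 0).norm_add_sub]
  norm_num
  ring

end Observable

/-! ### The resolvent and the isometry of the second party -/

section Resolvent

variable {H : Type u} [NormedAddCommGroup H] [InnerProductSpace ℂ H]

theorem norm_halfAnti_le (B : Fin 2 → DichotomicObservable H) :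
    ‖halfAnti (fun i => (B i).op)‖ ≤ 1 := by
  refine ContinuousLinearMap.opNorm_le_bound _ zero_le_one fun v => ?_
  have e : halfAnti (fun i => (B i).op) v =
    (1 / 2 : ℂ) • ((B 0).op ((B 1).op v) + (B 1).op ((B 0).op v)) := rfl
  have := norm_add_le ((B 0).op ((B 1).op v)) ((B 1).op ((B 0).op v))
  simp only [DichotomicObservable.norm_op] at this
  rw [e, norm_smul]
  norm_num
  linarith

/-- Neumann series, which uses completeness. The norm bound depends on `t` alone, as uniformity over
realizations demands. -/
theorem exists_resolvent [CompleteSpace H] (B : Fin 2 → DichotomicObservable H) {t : ℝ}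
    (ht : |t| < 1) : ∃ R : H →L[ℂ] H,
      R * (1 - (t : ℂ) • halfAnti (fun i => (B i).op)) = 1 ∧
      (1 - (t : ℂ) • halfAnti (fun i => (B i).op)) * R = 1 ∧ ‖R‖ ≤ (1 - |t|)⁻¹ := by
  set X := halfAnti (fun i => (B i).op)
  have hX : ‖(t : ℂ) • X‖ ≤ |t| := by
    rw [norm_smul, Complex.norm_real, Real.norm_eq_abs]
    exact mul_le_of_le_one_right (abs_nonneg t) (norm_halfAnti_le B)
  let U := Units.oneSub ((t : ℂ) • X) (hX.trans_lt ht)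
  refine ⟨↑U⁻¹, U.inv_mul, U.mul_inv,
    ContinuousLinearMap.opNorm_le_bound _ (by simpa using ht.le) fun v => ?_⟩
  set w := (↑U⁻¹ : H →L[ℂ] H) v
  have hw : w - ((t : ℂ) • X) w = v := DFunLike.congr_fun U.mul_inv v
  have h1 : ‖w‖ - |t| * ‖w‖ ≤ ‖v‖ := by
    have := norm_sub_norm_le w (((t : ℂ) • X) w)
    rw [hw] at this
    linarith [((t : ℂ) • X).le_of_opNorm_le hX w]
  rw [inv_mul_eq_div, le_div_iff₀ (by linarith)]
  linarith

/-- On the -1 eigenspace of B₀ the first Kraus operator is the Möbius transform (X - t)(1 - tX)⁻¹,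
which vanishes at X = t. The second supplies its defect (1 - t²)(1 - X²)(1 - tX)⁻², so the squared
norms add up for every vector and not only for optimal states. -/
theorem norm_krausB' (B : Fin 2 → DichotomicObservable H) {m n : ℝ} (hmn : m ^ 2 + n ^ 2 = 1)
    {R : H →L[ℂ] H} (hR : R * (1 - (m ^ 2 - n ^ 2 : ℂ) • halfAnti (fun i => (B i).op)) = 1)
    (hR' : (1 - (m ^ 2 - n ^ 2 : ℂ) • halfAnti (fun i => (B i).op)) * R = 1) (x : H) :
    ‖krausB' m n (fun i => (B i).op) R 0 x‖ ^ 2 + ‖krausB' m n (fun i => (B i).op) R 1 x‖ ^ 2 =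
      ‖x‖ ^ 2 := by
  obtain ⟨t, ht⟩ : ∃ t : ℝ, t = m ^ 2 - n ^ 2 := ⟨_, rfl⟩
  have htC : (m ^ 2 - n ^ 2 : ℂ) = t := by rw [ht]; push_cast; rfl
  rw [htC] at hR hR'
  obtain ⟨X, hXdef⟩ : ∃ X, X = halfAnti (fun i => (B i).op) := ⟨_, rfl⟩
  have hX : ∀ v, X v = (1 / 2 : ℂ) • ((B 0).op ((B 1).op v) + (B 1).op ((B 0).op v)) := by
    rw [hXdef]; exact fun v => rfl
  have r1 : ∀ v, R (v - (t : ℂ) • X v) = v := by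
    rw [hXdef]; exact fun v => DFunLike.congr_fun hR v
  have r2 : ∀ v, R v - (t : ℂ) • X (R v) = v := by
    rw [hXdef]; exact fun v => DFunLike.congr_fun hR' v
  obtain ⟨y, hy⟩ : ∃ y, y = (1 / 2 : ℂ) • R (x - (B 0).op x) := ⟨_, rfl⟩
  have hp : y - (t : ℂ) • X y = (1 / 2 : ℂ) • (x - (B 0).op x) := by
    have := r2 (x - (B 0).op x)
    rw [hy, map_smul]
    linear_combination (norm := module) (1 / 2 : ℂ) • this
  have hX0 : ∀ v, X ((B 0).op v) = (B 0).op (X v) := fun v => by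
    simp only [hX, map_smul, map_add, DichotomicObservable.op_op, add_comm]
  have hX1 : ∀ v, X ((B 1).op v) = (B 1).op (X v) := fun v => by
    simp only [hX, map_smul, map_add, DichotomicObservable.op_op, add_comm]
  -- X commutes with B₀, and 1 - tX is injective.
  have hy0 : (B 0).op y = -y := by
    have e := congrArg (B 0).op hp
    simp only [map_sub, map_smul, DichotomicObservable.op_op] at e
    have f := r1 (y + (B 0).op y)
    have g : y + (B 0).op y - (t : ℂ) • X (y + (B 0).op y) = 0 := by
      rw [map_add, hX0]
      linear_combination (norm := module) hp + e
    rw [g, map_zero] at f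
    exact eq_neg_of_add_eq_zero_right f.symm
  have hq : (B 0).op ((B 1).op y) = (2 : ℂ) • X y + (B 1).op y := by
    rw [hX, hy0, map_neg]; module
  have hRq : R ((B 1).op (x - (B 0).op x) + (B 0).op ((B 1).op (x - (B 0).op x))) =
      (2 : ℂ) • ((B 1).op y + (B 0).op ((B 1).op y)) := by
    have e : x - (B 0).op x = (2 : ℂ) • (y - (t : ℂ) • X y) := by rw [hp]; module
    rw [← r1 ((2 : ℂ) • ((B 1).op y + (B 0).op ((B 1).op y))), e]
    congr 1
    simp only [map_add, map_sub, map_smul, hX0, hX1]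
    module
  have k0 : krausB' m n (fun i => (B i).op) R 0 x =
      (1 / 2 : ℂ) • (x + (B 0).op x) + (X y - (t : ℂ) • y) := by
    have e : krausB' m n (fun i => (B i).op) R 0 x = (1 / 2 : ℂ) • (x + (B 0).op x) +
      (1 / 2 : ℂ) • (X (R (x - (B 0).op x)) - (m ^ 2 - n ^ 2 : ℂ) • R (x - (B 0).op x)) := by
        rw [hXdef]; rfl
    rw [e, hy, htC, map_smul]
    module
  have k1 : krausB' m n (fun i => (B i).op) R 1 x =
      -(m * n : ℂ) • ((B 1).op y + (B 0).op ((B 1).op y)) := by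
    have e : krausB' m n (fun i => (B i).op) R 1 x = -(m * n / 2 : ℂ) •
      R ((B 1).op (x - (B 0).op x) + (B 0).op ((B 1).op (x - (B 0).op x))) := rfl
    rw [e, hRq]
    module
  have n1 : ‖krausB' m n (fun i => (B i).op) R 1 x‖ ^ 2 =
      4 * m ^ 2 * n ^ 2 * (‖y‖ ^ 2 - ‖X y‖ ^ 2) := by
    have e := (B 0).norm_add_sub ((B 1).op y)
    have f : (B 1).op y - (B 0).op ((B 1).op y) = (-2 : ℂ) • X y := by rw [hq]; module
    rw [f, norm_smul, DichotomicObservable.norm_op, mul_pow] at e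
    norm_num at e
    rw [k1, norm_smul, mul_pow]
    simp only [norm_neg, norm_mul, Complex.norm_real, Real.norm_eq_abs, mul_pow, sq_abs]
    linear_combination m ^ 2 * n ^ 2 * e
  -- The two summands lie in opposite eigenspaces of B₀: applying B₀ flips the relative sign, and
  -- the parallelogram law gives Pythagoras.
  have n0 : ‖krausB' m n (fun i => (B i).op) R 0 x‖ ^ 2 =
      ‖(1 / 2 : ℂ) • (x + (B 0).op x)‖ ^ 2 + ‖X y - (t : ℂ) • y‖ ^ 2 := by
    have e := parallelogram_law_with_norm ℂ ((1 / 2 : ℂ) • (x + (B 0).op x)) (X y - (t : ℂ) • y)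
    have f : (B 0).op ((1 / 2 : ℂ) • (x + (B 0).op x) + (X y - (t : ℂ) • y)) =
        (1 / 2 : ℂ) • (x + (B 0).op x) - (X y - (t : ℂ) • y) := by
      simp only [map_add, map_sub, map_smul, ← hX0, hy0, map_neg, DichotomicObservable.op_op]
      module
    rw [← f, DichotomicObservable.norm_op, ← k0] at e
    linarith
  have n2 : ‖X y - (t : ℂ) • y‖ ^ 2 =
      ‖X y‖ ^ 2 - 2 * t * RCLike.re (inner ℂ (X y) y) + t ^ 2 * ‖y‖ ^ 2 := by
    rw [norm_sub_sq (𝕜 := ℂ), inner_smul_right, norm_smul, mul_pow]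
    simp
    ring
  have n3 : ‖y - (t : ℂ) • X y‖ ^ 2 =
      ‖y‖ ^ 2 - 2 * t * RCLike.re (inner ℂ (X y) y) + t ^ 2 * ‖X y‖ ^ 2 := by
    rw [norm_sub_sq (𝕜 := ℂ), inner_smul_right, norm_smul, mul_pow, ← inner_re_symm]
    simp
    ring
  have n4 := (B 0).norm_add_sub x
  rw [hp] at n3
  rw [n0, n1, n2]
  rw [norm_smul, mul_pow] at n3 ⊢
  norm_num at n3 ⊢
  have hmn4 : 4 * m ^ 2 * n ^ 2 = 1 - t ^ 2 := by
    rw [ht]; linear_combination (m ^ 2 + n ^ 2 + 1) * hmn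
  rw [hmn4]
  linarith

theorem norm_krausB (B : Fin 2 → DichotomicObservable H) {m n k l : ℝ} (hmn : m ^ 2 + n ^ 2 = 1)
    (hkl : k ^ 2 + l ^ 2 = 1)
    {R : H →L[ℂ] H} (hR : R * (1 - (m ^ 2 - n ^ 2 : ℂ) • halfAnti (fun i => (B i).op)) = 1)
    (hR' : (1 - (m ^ 2 - n ^ 2 : ℂ) • halfAnti (fun i => (B i).op)) * R = 1) (x : H) :
    ‖krausB m n k l (fun i => (B i).op) R 0 x‖ ^ 2 +
      ‖krausB m n k l (fun i => (B i).op) R 1 x‖ ^ 2 = ‖x‖ ^ 2 := by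
  rw [← norm_krausB' B hmn hR hR' x]
  set a := krausB' m n (fun i => (B i).op) R 0 x with ha
  set b := krausB' m n (fun i => (B i).op) R 1 x with hb
  have e0 : krausB m n k l (fun i => (B i).op) R 0 x = (k : ℂ) • a - (l : ℂ) • b := rfl
  have e1 : krausB m n k l (fun i => (B i).op) R 1 x = (l : ℂ) • a + (k : ℂ) • b := rfl
  rw [e0, e1, norm_sub_sq (𝕜 := ℂ), norm_add_sq (𝕜 := ℂ)]
  simp only [inner_smul_left, inner_smul_right, norm_smul, mul_pow, Complex.norm_real,
    Real.norm_eq_abs, sq_abs, Complex.conj_ofReal, RCLike.re_to_complex, Complex.re_ofReal_mul]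
  linear_combination (‖a‖ ^ 2 + ‖b‖ ^ 2) * hkl

end Resolvent

/-! ### The sum-of-squares identity for the value -/

section SumOfSquares

variable {E : Type*} [NormedAddCommGroup E] [InnerProductSpace ℂ E]
  {A B : Fin 2 → Module.End ℂ E}

theorem CommutingInvolutions.norm_sq_add_norm_sq (h : CommutingInvolutions A B)
    (hA : ∀ i, (A i).IsSymmetric) (hB : ∀ i, (B i).IsSymmetric) {α b : ℝ}
    (hb : b ^ 2 = 8 + 2 * α ^ 2) {ψ : E} (hψ : ‖ψ‖ = 1) :
    ‖bell α A B ψ - (b : ℂ) • ψ‖ ^ 2 + ‖coBell α A B ψ‖ ^ 2 =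
      2 * b * (b - (inner ℂ ψ (bell α A B ψ)).re) := by
  have s1 : ∀ x y, inner ℂ (bell α A B x) y = inner ℂ x (bell α A B y) := by
    intro x y
    simp only [bell, inner_add_left, inner_add_right, inner_sub_right, inner_sub_left,
      inner_smul_left, inner_smul_right, Complex.conj_ofReal, hA _ _ _, hB _ _ _, map_add,
      map_sub, h.comm]
  have s2 : ∀ x y, inner ℂ (coBell α A B x) y = inner ℂ x (coBell α A B y) := by
    intro x y
    simp only [coBell, inner_add_left, inner_add_right, inner_sub_right, inner_sub_left,
      inner_smul_left, inner_smul_right, Complex.conj_ofReal, hA _ _ _, hB _ _ _, map_add,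
      map_sub, h.comm]
  have e : ‖bell α A B ψ‖ ^ 2 + ‖coBell α A B ψ‖ ^ 2 = b ^ 2 := by
    have f := congrArg (fun v => (inner ℂ ψ v).re) (h.bell_bell_add α ψ)
    simp only [inner_add_right, Complex.add_re, inner_smul_right] at f
    rw [← s1 ψ (bell α A B ψ), ← s2 ψ (coBell α A B ψ)] at f
    have hbC : (8 + 2 * α ^ 2 : ℂ) = ((b ^ 2 : ℝ) : ℂ) := by rw [hb]; push_cast; rfl
    rw [hbC, Complex.re_ofReal_mul, ← RCLike.re_to_complex, ← RCLike.re_to_complex,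
      ← RCLike.re_to_complex, inner_self_eq_norm_sq, inner_self_eq_norm_sq,
      inner_self_eq_norm_sq, hψ] at f
    linarith
  rw [norm_sub_sq (𝕜 := ℂ), inner_smul_right, norm_smul, mul_pow, hψ, s1]
  simp
  linarith

end SumOfSquares

/-! ### Families of vectors modulo O(ε) -/

section SmallFamilies

variable {ι : Type*} (H : ι → Type*) [∀ i, NormedAddCommGroup (H i)]
  [∀ i, InnerProductSpace ℂ (H i)] (ε : ι → ℝ)

/-- The families of vectors that are `O(ε)`, uniformly in the index. -/
def smallFamilies : Submodule ℂ (∀ i, H i) where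
  carrier := {v | ∃ C : ℝ, ∀ i, ‖v i‖ ≤ C * ε i}
  zero_mem' := ⟨0, fun i => by simp⟩
  add_mem' := by
    rintro v w ⟨C, hC⟩ ⟨D, hD⟩
    exact ⟨C + D, fun i => (norm_add_le _ _).trans (by linarith [hC i, hD i])⟩
  smul_mem' := by
    rintro t v ⟨C, hC⟩
    refine ⟨‖t‖ * C, fun i => ?_⟩
    rw [Pi.smul_apply, norm_smul, mul_assoc]
    exact mul_le_mul_of_nonneg_left (hC i) (norm_nonneg t)

variable {H ε}

/-- A uniformly bounded family of operators acts on families of vectors modulo `O(ε)`. -/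
def descend (T : ∀ i, H i →L[ℂ] H i) (hT : ∃ K : ℝ, ∀ i, ‖T i‖ ≤ K) :
    Module.End ℂ ((∀ i, H i) ⧸ smallFamilies H ε) :=
  Submodule.mapQ _ _ (LinearMap.pi fun i => (T i).toLinearMap ∘ₗ LinearMap.proj i) <| by
    obtain ⟨K, hK⟩ := hT
    rintro v ⟨C, hC⟩
    refine ⟨K * C, fun i => ?_⟩
    have : 0 ≤ K := (norm_nonneg _).trans (hK i)
    calc ‖T i (v i)‖ ≤ K * ‖v i‖ := (T i).le_of_opNorm_le (hK i) _
      _ ≤ K * (C * ε i) := mul_le_mul_of_nonneg_left (hC i) this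
      _ = K * C * ε i := (mul_assoc _ _ _).symm

variable {A B : ∀ i, Fin 2 → H i →L[ℂ] H i} {α c s m n k l : ℝ}

theorem descend_krausA (hA : ∀ j, ∃ K : ℝ, ∀ i, ‖A i j‖ ≤ K) (a : Fin 2) (v : ∀ i, H i) :
    krausA (fun j => descend (ε := ε) (fun i => A i j) (hA j)) a ((smallFamilies H ε).mkQ v) =
      (smallFamilies H ε).mkQ fun i => krausA (A i) a (v i) := by
  fin_cases a <;> rfl

theorem descend_krausB (hB : ∀ j, ∃ K : ℝ, ∀ i, ‖B i j‖ ≤ K) {R : ∀ i, H i →L[ℂ] H i}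
    (hR : ∃ K : ℝ, ∀ i, ‖R i‖ ≤ K) (b : Fin 2) (v : ∀ i, H i) :
    krausB m n k l (fun j => descend (ε := ε) (fun i => B i j) (hB j)) (descend R hR) b
        ((smallFamilies H ε).mkQ v) =
      (smallFamilies H ε).mkQ fun i => krausB m n k l (B i) (R i) b (v i) := by
  fin_cases b <;> rfl

/-- In the quotient by O(ε) the hypotheses become exact equations, so `krausB_apply` applies there.
Equality of classes in the quotient means an estimate with one constant for all indices. -/
theorem krausA_krausB_uniform (p : IdealScalars α c s m n k l) (hn0 : 0 < n)
    (h : ∀ i, CommutingInvolutions (fun j => (A i j).toLinearMap) (fun j => (B i j).toLinearMap))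
    (hA : ∀ j, ∃ K : ℝ, ∀ i, ‖A i j‖ ≤ K) (hB : ∀ j, ∃ K : ℝ, ∀ i, ‖B i j‖ ≤ K)
    {R : ∀ i, H i →L[ℂ] H i} (hRK : ∃ K : ℝ, ∀ i, ‖R i‖ ≤ K)
    (hR : ∀ i, R i * (1 - (m ^ 2 - n ^ 2 : ℂ) • halfAnti (B i)) = 1) {ψ : ∀ i, H i} {K : ℝ}
    (h1 : ∀ i, ‖bell α (fun j => (A i j).toLinearMap) (fun j => (B i j).toLinearMap) (ψ i) -
      ((4 * m : ℝ) : ℂ) • ψ i‖ ≤ K * ε i)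
    (h2 : ∀ i, ‖coBell α (fun j => (A i j).toLinearMap) (fun j => (B i j).toLinearMap) (ψ i)‖ ≤
      K * ε i) :
    (∃ C : ℝ, ∀ i, ‖krausA (A i) 0 (krausB m n k l (B i) (R i) 1 (ψ i))‖ ≤ C * ε i) ∧
    (∃ C : ℝ, ∀ i, ‖krausA (A i) 1 (krausB m n k l (B i) (R i) 0 (ψ i))‖ ≤ C * ε i) ∧
    (∃ C : ℝ, ∀ i, ‖(s : ℂ) • krausA (A i) 0 (krausB m n k l (B i) (R i) 0 (ψ i)) -
      (c : ℂ) • krausA (A i) 1 (krausB m n k l (B i) (R i) 1 (ψ i))‖ ≤ C * ε i) := by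
  set q := (smallFamilies H ε).mkQ
  have hq : ∀ v, q v = 0 ↔ ∃ C : ℝ, ∀ i, ‖v i‖ ≤ C * ε i := fun v =>
    Submodule.Quotient.mk_eq_zero _
  have ind : ∀ {P : (∀ i, H i) ⧸ smallFamilies H ε → Prop}, (∀ v, P (q v)) → ∀ v, P v :=
    fun hP v => Submodule.Quotient.induction_on _ v hP
  have hinv : CommutingInvolutions (fun j => descend (ε := ε) (fun i => A i j) (hA j))
      (fun j => descend (ε := ε) (fun i => B i j) (hB j)) :=
    { invol_left := fun j => ind fun v => congrArg q (funext fun i => (h i).invol_left j (v i))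
      invol_right := fun j => ind fun v => congrArg q (funext fun i => (h i).invol_right j (v i))
      comm := fun a b => ind fun v => congrArg q (funext fun i => (h i).comm a b (v i)) }
  have hRq : descend (ε := ε) R hRK * (1 - (m ^ 2 - n ^ 2 : ℂ) •
      halfAnti (fun j => descend (ε := ε) (fun i => B i j) (hB j))) = 1 :=
    LinearMap.ext (ind fun v => congrArg q (funext fun i => DFunLike.congr_fun (hR i) (v i)))
  obtain ⟨r1, r2, r3⟩ := hinv.krausB_apply p hn0 (ψ := q ψ)
    (sub_eq_zero.mp ((hq _).mpr ⟨K, h1⟩)) ((hq _).mpr ⟨K, h2⟩) hRq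
  rw [descend_krausB, descend_krausA] at r1 r2
  rw [descend_krausB, descend_krausB, descend_krausA, descend_krausA, ← sub_eq_zero] at r3
  exact ⟨(hq _).mp r1, (hq _).mp r2, (hq _).mp r3⟩

end SmallFamilies

/-! ### Realizations: the upper bound and uniform estimates -/

namespace BellRealization

variable {HA : Type u} {HB : Type v} [NormedAddCommGroup HA] [InnerProductSpace ℂ HA]
  [NormedAddCommGroup HB] [InnerProductSpace ℂ HB] (R : BellRealization HA HB)

theorem opA_eq_liftLeft (x : Fin 2) : R.opA x = liftLeft HA HB (R.A x).op :=
  continuousLinearMap_ext_elemTensor fun a b => by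
    rw [liftLeft_elemTensor]
    exact tensorIsometry_elemTensor _ _ a b

theorem opB_eq_liftRight (y : Fin 2) : R.opB y = liftRight HA HB (R.B y).op :=
  continuousLinearMap_ext_elemTensor fun a b => by
    rw [liftRight_elemTensor]
    exact tensorIsometry_elemTensor _ _ a b

theorem opA_opA (x : Fin 2) (v : HilbertTensor HA HB) : R.opA x (R.opA x v) = v := by
  have : R.opA x * R.opA x = 1 := by
    rw [opA_eq_liftLeft, ← map_mul, DichotomicObservable.op_mul_op, map_one]
  exact DFunLike.congr_fun this v

theorem opB_opB (y : Fin 2) (v : HilbertTensor HA HB) : R.opB y (R.opB y v) = v := by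
  have : R.opB y * R.opB y = 1 := by
    rw [opB_eq_liftRight, ← map_mul, DichotomicObservable.op_mul_op, map_one]
  exact DFunLike.congr_fun this v

theorem opB_opA (x y : Fin 2) (v : HilbertTensor HA HB) :
    R.opB y (R.opA x v) = R.opA x (R.opB y v) := by
  rw [opA_eq_liftLeft, opB_eq_liftRight, liftRight_liftLeft_comm]

theorem norm_opA_le (x : Fin 2) : ‖R.opA x‖ ≤ 1 :=
  LinearIsometry.norm_toContinuousLinearMap_le _

theorem norm_opB_le (y : Fin 2) : ‖R.opB y‖ ≤ 1 :=
  LinearIsometry.norm_toContinuousLinearMap_le _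

theorem commutingInvolutions : CommutingInvolutions (fun x => (R.opA x).toLinearMap)
    (fun y => (R.opB y).toLinearMap) :=
  ⟨R.opA_opA, R.opB_opB, R.opB_opA⟩

theorem isSymmetric_opA (x : Fin 2) : (R.opA x).toLinearMap.IsSymmetric := fun v w => by
  have := (tensorIsometry (R.A x).toUnitary.toLinearIsometry
    (LinearIsometry.id (E := HB) (R := ℂ))).inner_map_map v (R.opA x w)
  refine Eq.trans ?_ this
  exact congrArg (inner ℂ (R.opA x v)) (R.opA_opA x w).symm

theorem isSymmetric_opB (y : Fin 2) : (R.opB y).toLinearMap.IsSymmetric := fun v w => by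
  have := (tensorIsometry (LinearIsometry.id (E := HA) (R := ℂ))
    (R.B y).toUnitary.toLinearIsometry).inner_map_map v (R.opB y w)
  refine Eq.trans ?_ this
  exact congrArg (inner ℂ (R.opB y v)) (R.opB_opB y w).symm

theorem norm_sq_add_norm_sq {α b : ℝ} (hb : b ^ 2 = 8 + 2 * α ^ 2) :
    ‖bell α (fun x => (R.opA x).toLinearMap) (fun y => (R.opB y).toLinearMap) R.state -
        (b : ℂ) • R.state‖ ^ 2 +
      ‖coBell α (fun x => (R.opA x).toLinearMap) (fun y => (R.opB y).toLinearMap) R.state‖ ^ 2 =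
      2 * b * (b - R.value α) :=
  R.commutingInvolutions.norm_sq_add_norm_sq R.isSymmetric_opA R.isSymmetric_opB hb R.norm_state

theorem value_le (α : ℝ) : R.value α ≤ maxValue α := by
  have hpos : 0 < maxValue α := Real.sqrt_pos.mpr (by positivity)
  have := R.norm_sq_add_norm_sq (α := α) (b := maxValue α) (Real.sq_sqrt (by positivity))
  have h0 : 0 ≤ 2 * maxValue α * (maxValue α - R.value α) := by
    rw [← this]; positivity
  linarith [nonneg_of_mul_nonneg_right h0 (by positivity)]

end BellRealization

/-- A realization whose value is within `ε ^ 2` of the maximal one, together with a left inverse of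
norm at most `K` of `1 - (m² - n²) X`, where `X` is half the anticommutator of the observables of
the second party. -/
structure NearOptimal (α m n K : ℝ) where
  HA : Type u
  HB : Type v
  [normA : NormedAddCommGroup HA]
  [innerA : InnerProductSpace ℂ HA]
  [normB : NormedAddCommGroup HB]
  [innerB : InnerProductSpace ℂ HB]
  real : BellRealization HA HB
  ε : ℝ
  ε_nonneg : 0 ≤ ε
  value_ge : maxValue α - ε ^ 2 ≤ real.value α
  inv : HB →L[ℂ] HB
  norm_inv : ‖inv‖ ≤ K
  inv_mul : inv * (1 - (m ^ 2 - n ^ 2 : ℂ) • halfAnti (fun i => (real.B i).op)) = 1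

attribute [instance] NearOptimal.normA NearOptimal.innerA NearOptimal.normB NearOptimal.innerB

theorem IdealScalars.maxValue_eq {α c s m n k l : ℝ} (p : IdealScalars α c s m n k l) :
    maxValue α = 4 * m := by
  rw [maxValue, ← p.bound, show 16 * m ^ 2 = (4 * m) ^ 2 by ring,
    Real.sqrt_sq (by linarith [p.m_pos])]

/-- The index set consists of all near-optimal realizations together with their ε and resolvent, so
the constant is chosen before any of them. -/
theorem exists_uniform_bound {α c s m n k l : ℝ} (p : IdealScalars α c s m n k l)
    (hn0 : 0 < n) (K : ℝ) :
    ∃ C : ℝ, ∀ (HA : Type u) (HB : Type v)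
      [NormedAddCommGroup HA] [InnerProductSpace ℂ HA]
      [NormedAddCommGroup HB] [InnerProductSpace ℂ HB] (R : BellRealization HA HB) (ε : ℝ),
      0 ≤ ε → maxValue α - ε ^ 2 ≤ R.value α → ∀ S : HB →L[ℂ] HB, ‖S‖ ≤ K →
      S * (1 - (m ^ 2 - n ^ 2 : ℂ) • halfAnti (fun i => (R.B i).op)) = 1 →
      ∀ v : Fin 2 → Fin 2 → HilbertTensor HA HB,
      (∀ i j, v i j = liftLeft HA HB (krausA (fun x => (R.A x).op) i)
        (liftRight HA HB (krausB m n k l (fun y => (R.B y).op) S j) R.state)) →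
      ‖v 0 1‖ ≤ C * ε ∧ ‖v 1 0‖ ≤ C * ε ∧ ‖(s : ℂ) • v 0 0 - (c : ℂ) • v 1 1‖ ≤ C * ε := by
  -- As b = 4m, the right side of the sum-of-squares identity is at most 8mε².
  have hsq : ∀ I : NearOptimal.{u, v} α m n K, 2 * (4 * m) * (4 * m - I.real.value α) ≤
      (√(8 * m) * I.ε) ^ 2 := fun I => by
    rw [mul_pow, Real.sq_sqrt (by linarith [p.m_pos])]
    nlinarith [I.value_ge, p.m_pos, p.maxValue_eq]
  have hsum := fun I : NearOptimal.{u, v} α m n K =>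
    I.real.norm_sq_add_norm_sq (α := α) (b := 4 * m) (by linarith [p.bound])
  have hnn : ∀ I : NearOptimal.{u, v} α m n K, 0 ≤ √(8 * m) * I.ε := fun I =>
    mul_nonneg (Real.sqrt_nonneg _) I.ε_nonneg
  obtain ⟨⟨C1, h1⟩, ⟨C2, h2⟩, ⟨C3, h3⟩⟩ := krausA_krausB_uniform (ι := NearOptimal.{u, v} α m n K)
    (H := fun I => HilbertTensor I.HA I.HB) (ε := fun I => I.ε) p hn0
    (A := fun I => I.real.opA) (B := fun I => I.real.opB)
    (fun I => I.real.commutingInvolutions)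
    (fun j => ⟨1, fun I => I.real.norm_opA_le j⟩) (fun j => ⟨1, fun I => I.real.norm_opB_le j⟩)
    (R := fun I => liftRight I.HA I.HB I.inv)
    ⟨K, fun I => (norm_liftRight_le _).trans I.norm_inv⟩
    (fun I => by
      have := congrArg (liftRight I.HA I.HB) I.inv_mul
      simpa [halfAnti, -Complex.coe_smul, BellRealization.opB_eq_liftRight] using this)
    (ψ := fun I => I.real.state) (K := √(8 * m))
    (fun I => abs_le_of_sq_le_sq' (by
      nlinarith [hsq I, hsum I, sq_nonneg ‖coBell α (fun x => (I.real.opA x).toLinearMap)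
        (fun y => (I.real.opB y).toLinearMap) I.real.state‖]) (hnn I) |>.2)
    (fun I => abs_le_of_sq_le_sq' (by
      nlinarith [hsq I, hsum I, sq_nonneg ‖bell α (fun x => (I.real.opA x).toLinearMap)
        (fun y => (I.real.opB y).toLinearMap) I.real.state -
          ((4 * m : ℝ) : ℂ) • I.real.state‖]) (hnn I) |>.2)
  refine ⟨max C1 (max C2 C3), ?_⟩
  intro HA HB _ _ _ _ R ε hε hval S hS hinv v hv
  let I : NearOptimal.{u, v} α m n K := ⟨HA, HB, R, ε, hε, hval, S, hS, hinv⟩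
  have hv' : ∀ i j, v i j = krausA R.opA i
      (krausB m n k l R.opB (liftRight HA HB S) j R.state) := fun i j => by
    rw [hv, map_krausA, map_krausB]
    simp only [← BellRealization.opA_eq_liftLeft, ← BellRealization.opB_eq_liftRight]
  simp only [hv']
  exact ⟨(h1 I).trans (mul_le_mul_of_nonneg_right (le_max_left _ _) hε),
    (h2 I).trans (mul_le_mul_of_nonneg_right
      ((le_max_left _ _).trans (le_max_right _ _)) hε),
    (h3 I).trans (mul_le_mul_of_nonneg_right
      ((le_max_right _ _).trans (le_max_right _ _)) hε)⟩

/-! ### Closeness to a product with the target state -/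

section Junk

variable {HA : Type u} {HB : Type v} [NormedAddCommGroup HA] [InnerProductSpace ℂ HA]
  [NormedAddCommGroup HB] [InnerProductSpace ℂ HB]

theorem junkTensor_entangledState (w : HilbertTensor HA HB) (θ : ℝ) :
    junkTensor w (entangledState θ) =
      (Real.cos θ : ℂ) • tensorIsometry (appendKet HA 0) (appendKet HB 0) w +
        (Real.sin θ : ℂ) • tensorIsometry (appendKet HA 1) (appendKet HB 1) w := by
  simp [junkTensor, entangledState, -Complex.coe_smul]

theorem inner_elemTensor (x x' : HA) (y y' : HB) :
    inner ℂ (elemTensor x y) (elemTensor x' y') = inner ℂ x x' * inner ℂ y y' := by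
  rw [elemTensor, elemTensor, UniformSpace.Completion.inner_coe, TensorProduct.inner_tmul]

theorem inner_appendKet (x y : HA) :
    inner ℂ (appendKet HA 0 x) (appendKet HA 1 y) = 0 := by
  simp [appendKet, ket, EuclideanSpace.inner_single_left]

theorem inner_tensorIsometry_appendKet (v w : HilbertTensor HA HB) :
    inner ℂ (tensorIsometry (appendKet HA 0) (appendKet HB 0) v)
      (tensorIsometry (appendKet HA 1) (appendKet HB 1) w) = 0 := by
  have h1 : ∀ x y, (innerSL ℂ (elemTensor (appendKet HA 0 x) (appendKet HB 0 y))).comp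
      (tensorIsometry (appendKet HA 1) (appendKet HB 1)).toContinuousLinearMap = 0 := fun x y =>
    continuousLinearMap_ext_elemTensor fun x' y' => by
      simp only [ContinuousLinearMap.comp_apply, LinearIsometry.coe_toContinuousLinearMap,
        tensorIsometry_elemTensor, innerSL_apply_apply, inner_elemTensor, inner_appendKet,
        zero_mul, zero_apply]
  have h2 : (innerSL ℂ (tensorIsometry (appendKet HA 1) (appendKet HB 1) w)).comp
      (tensorIsometry (appendKet HA 0) (appendKet HB 0)).toContinuousLinearMap = 0 :=
    continuousLinearMap_ext_elemTensor fun x y => by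
      simp only [ContinuousLinearMap.comp_apply, LinearIsometry.coe_toContinuousLinearMap,
        tensorIsometry_elemTensor, innerSL_apply_apply, zero_apply]
      exact inner_eq_zero_symm.mp (DFunLike.congr_fun (h1 x y) w)
  exact inner_eq_zero_symm.mp (DFunLike.congr_fun h2 v)

theorem norm_junkTensor_entangledState (w : HilbertTensor HA HB) (θ : ℝ) :
    ‖junkTensor w (entangledState θ)‖ = ‖w‖ := by
  have h : inner ℂ ((Real.cos θ : ℂ) • tensorIsometry (appendKet HA 0) (appendKet HB 0) w)
      ((Real.sin θ : ℂ) • tensorIsometry (appendKet HA 1) (appendKet HB 1) w) = 0 := by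
    rw [inner_smul_left, inner_smul_right, inner_tensorIsometry_appendKet, mul_zero, mul_zero]
  have e := norm_add_sq_eq_norm_sq_add_norm_sq_of_inner_eq_zero (𝕜 := ℂ) _ _ h
  rw [← junkTensor_entangledState, norm_smul, norm_smul, LinearIsometry.norm_map,
    LinearIsometry.norm_map, Complex.norm_real, Complex.norm_real, Real.norm_eq_abs,
    Real.norm_eq_abs] at e
  refine (pow_left_inj₀ (norm_nonneg _) (norm_nonneg _) two_ne_zero).mp ?_
  have f := Real.cos_sq_add_sin_sq θ
  rw [← sq_abs (Real.cos θ), ← sq_abs (Real.sin θ)] at f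
  linear_combination e + ‖w‖ ^ 2 * f

theorem junkTensor_sub (v w : HilbertTensor HA HB) (θ : ℝ) :
    junkTensor (v - w) (entangledState θ) =
      junkTensor v (entangledState θ) - junkTensor w (entangledState θ) := by
  simp only [junkTensor_entangledState, map_sub]
  module

theorem exists_unit_vector_near {E : Type*} [NormedAddCommGroup E] [NormedSpace ℂ E] {e : E}
    (he : ‖e‖ = 1) (w : E) : ∃ j : E, ‖j‖ = 1 ∧ ‖w - j‖ = |1 - ‖w‖| := by
  by_cases hw : w = 0
  · exact ⟨e, he, by simp [hw, he]⟩
  · have hw' : ‖w‖ ≠ 0 := norm_ne_zero_iff.mpr hw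
    refine ⟨((‖w‖⁻¹ : ℝ) : ℂ) • w, by simp [norm_smul, hw'], ?_⟩
    have : w - ((‖w‖⁻¹ : ℝ) : ℂ) • w = ((1 - ‖w‖⁻¹ : ℝ) : ℂ) • w := by push_cast; module
    rw [this, norm_smul, Complex.norm_real, Real.norm_eq_abs, ← abs_norm w, ← abs_mul, sub_mul,
      abs_norm, inv_mul_cancel₀ hw', one_mul, abs_sub_comm]

/-- A vector whose components nearly are those of a product of some vector with the state
`cos θ |00⟩ + sin θ |11⟩` is near the product of a unit vector with that state. -/
theorem exists_junk {u : HilbertTensor (HA ⊗[ℂ] Qubit) (HB ⊗[ℂ] Qubit)} (hu : ‖u‖ = 1)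
    {e : HilbertTensor HA HB} (he : ‖e‖ = 1) (v : Fin 2 → Fin 2 → HilbertTensor HA HB)
    (huv : u = ∑ i : Fin 2, ∑ j : Fin 2, tensorIsometry (appendKet HA i) (appendKet HB j) (v i j))
    {θ δ : ℝ} (h01 : ‖v 0 1‖ ≤ δ) (h10 : ‖v 1 0‖ ≤ δ)
    (h : ‖(Real.sin θ : ℂ) • v 0 0 - (Real.cos θ : ℂ) • v 1 1‖ ≤ δ) :
    ∃ junk : HilbertTensor HA HB, ‖junk‖ = 1 ∧
      ‖u - junkTensor junk (entangledState θ)‖ ≤ 8 * δ := by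
  set c := Real.cos θ with hc
  set s := Real.sin θ with hs
  have hcs : (c : ℂ) ^ 2 + (s : ℂ) ^ 2 = 1 := by
    rw [hc, hs]; exact_mod_cast Real.cos_sq_add_sin_sq θ
  -- Rotating (v 0 0, v 1 1) by θ separates the part `w` along the target from the error `d`.
  set w := (c : ℂ) • v 0 0 + (s : ℂ) • v 1 1 with hw
  set d := (s : ℂ) • v 0 0 - (c : ℂ) • v 1 1 with hd
  have h1 : ‖u - junkTensor w (entangledState θ)‖ ≤ 4 * δ := by
    have e0 : v 0 0 = (c : ℂ) • w + (s : ℂ) • d := by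
      rw [hw, hd]; linear_combination (norm := module) -hcs • v 0 0
    have e1 : v 1 1 = (s : ℂ) • w - (c : ℂ) • d := by
      rw [hw, hd]; linear_combination (norm := module) -hcs • v 1 1
    have e2 : u - junkTensor w (entangledState θ) =
        (s : ℂ) • tensorIsometry (appendKet HA 0) (appendKet HB 0) d +
        tensorIsometry (appendKet HA 0) (appendKet HB 1) (v 0 1) +
        tensorIsometry (appendKet HA 1) (appendKet HB 0) (v 1 0) -
        (c : ℂ) • tensorIsometry (appendKet HA 1) (appendKet HB 1) d := by
      rw [huv, junkTensor_entangledState, ← hc, ← hs, Fin.sum_univ_two, Fin.sum_univ_two, Fin.sum_univ_two,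
        e0, e1]
      simp only [map_add, map_sub, map_smul]
      module
    rw [e2]
    refine (norm_sub_le _ _).trans ?_
    have f1 := norm_add₃_le (a := (s : ℂ) • tensorIsometry (appendKet HA 0) (appendKet HB 0) d)
      (b := tensorIsometry (appendKet HA 0) (appendKet HB 1) (v 0 1))
      (c := tensorIsometry (appendKet HA 1) (appendKet HB 0) (v 1 0))
    simp only [norm_smul, LinearIsometry.norm_map, Complex.norm_real, Real.norm_eq_abs] at f1 ⊢
    have f2 : |s| * ‖d‖ ≤ ‖d‖ :=
      mul_le_of_le_one_left (norm_nonneg d) (Real.abs_sin_le_one θ)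
    have f3 : |c| * ‖d‖ ≤ ‖d‖ :=
      mul_le_of_le_one_left (norm_nonneg d) (Real.abs_cos_le_one θ)
    linarith
  obtain ⟨j, hj, hjw⟩ := exists_unit_vector_near he w
  refine ⟨j, hj, ?_⟩
  -- Normalizing `w` costs no more than the distance already incurred, since `u` is a unit vector;
  -- hence 8 = 4 + 4.
  have h2 : |1 - ‖w‖| ≤ 4 * δ := by
    have := abs_norm_sub_norm_le u (junkTensor w (entangledState θ))
    rw [hu, norm_junkTensor_entangledState] at this
    exact this.trans h1
  have h3 := norm_sub_le_norm_sub_add_norm_sub u (junkTensor w (entangledState θ))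
    (junkTensor j (entangledState θ))
  rw [← junkTensor_sub, norm_junkTensor_entangledState, hjw] at h3
  linarith

end Junk

/-! ### Trigonometry of the ideal realization -/

section Scalars

theorem angle_nonneg (α : ℝ) : 0 ≤ angle α := by
  unfold angle
  split_ifs
  · positivity
  · have := Real.arctan_nonneg.mpr (Real.sqrt_nonneg ((4 - α ^ 2) / (2 * α ^ 2)))
    linarith

theorem angle_le (α : ℝ) : angle α ≤ Real.pi / 4 := by
  unfold angle
  split_ifs
  · exact le_rfl
  · have := Real.arctan_lt_pi_div_two √((4 - α ^ 2) / (2 * α ^ 2))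
    linarith

theorem cos_two_mul_angle {α : ℝ} (hα0 : 0 ≤ α) (hα2 : α ≤ 2) :
    √(8 + 2 * α ^ 2) * Real.cos (2 * angle α) = 2 * α := by
  rcases hα0.eq_or_lt with rfl | hα
  · rw [angle, if_pos rfl, show 2 * (Real.pi / 4) = Real.pi / 2 by ring]
    simp
  · have h4 : 0 ≤ (4 - α ^ 2) / (2 * α ^ 2) := div_nonneg (by nlinarith) (by positivity)
    rw [angle, if_neg hα.ne', mul_div_cancel₀ _ two_ne_zero, Real.cos_arctan, Real.sq_sqrt h4,
      ← mul_div_assoc, mul_one, ← Real.sqrt_div (by positivity)]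
    rw [show (8 + 2 * α ^ 2) / (1 + (4 - α ^ 2) / (2 * α ^ 2)) = (2 * α) ^ 2 by
      have : 4 + α ^ 2 ≠ 0 := by positivity
      have : 2 * α ^ 2 + (4 - α ^ 2) ≠ 0 := ne_of_gt (by linarith [sq_nonneg α])
      field_simp
      ring]
    exact Real.sqrt_sq (by linarith)

theorem exists_idealScalars {α : ℝ} (hα0 : 0 ≤ α) (hα2 : α ≤ 2) :
    ∃ m n k l : ℝ, IdealScalars α (Real.cos (angle α)) (Real.sin (angle α)) m n k l := by
  set θ := angle α
  set m := √(8 + 2 * α ^ 2) / 4 with hm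
  have hm2 : 16 * m ^ 2 = 8 + 2 * α ^ 2 := by
    rw [hm, div_pow, Real.sq_sqrt (by positivity)]; ring
  have hm0 : 0 < m := by positivity
  have hm1 : m ≤ 1 := by nlinarith
  have hcos : 2 * m * Real.cos (2 * θ) = α := by
    linear_combination (1 / 2) * cos_two_mul_angle hα0 hα2
  have hpi := Real.pi_pos
  have hθ0 : 0 ≤ θ := angle_nonneg α
  have hθ1 : θ ≤ Real.pi / 4 := angle_le α
  have hk : √((1 + m) / 2) ^ 2 = (1 + m) / 2 := Real.sq_sqrt (by linarith)
  have hl : √((1 - m) / 2) ^ 2 = (1 - m) / 2 := Real.sq_sqrt (by linarith)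
  have hsin0 : 0 ≤ Real.sin (2 * θ) :=
    Real.sin_nonneg_of_nonneg_of_le_pi (by linarith) (by linarith)
  -- Half-angle formulas for cos μ = m.
  refine ⟨m, 2 * √((1 + m) / 2) * √((1 - m) / 2), √((1 + m) / 2), √((1 - m) / 2), ?_⟩
  exact
    { cs := Real.cos_sq_add_sin_sq θ
      kl := by rw [hk, hl]; ring
      hm := by rw [hk, hl]; ring
      hn := rfl
      hα := by rw [← Real.cos_two_mul', hcos]
      hmn := by
        have : 2 * m * Real.cos θ * Real.sin θ = m * Real.sin (2 * θ) := by
          rw [Real.sin_two_mul]; ring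
        rw [this]
        refine (pow_left_inj₀ (by positivity) (by positivity) two_ne_zero).mp ?_
        rw [mul_pow, mul_pow, mul_pow, hk, hl, Real.sin_sq]
        linear_combination (1 / 4) * (2 * m * Real.cos (2 * θ) + α) * hcos - hm2 / 8
      m_pos := hm0
      n_nonneg := by positivity
      bound := hm2 }

theorem IdealScalars.sq_add_sq {α c s m n k l : ℝ} (p : IdealScalars α c s m n k l) :
    m ^ 2 + n ^ 2 = 1 := by
  rw [p.hm, p.hn]
  linear_combination (k ^ 2 + l ^ 2 + 1) * p.kl

theorem IdealScalars.n_pos {α c s m n k l : ℝ} (p : IdealScalars α c s m n k l)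
    (hα0 : 0 ≤ α) (hα2 : α < 2) : 0 < n := by
  refine p.n_nonneg.lt_of_ne fun h => ?_
  have := p.sq_add_sq
  rw [← h] at this
  nlinarith [p.bound]

end Scalars

/-! ### Attainment on two qubits -/

section Attainment

/-- The real dichotomic qubit observable `a Z + b X`. -/
def qubitObservable (a b : ℝ) (h : a ^ 2 + b ^ 2 = 1) : DichotomicObservable Qubit :=
  let f : Qubit →ₗ[ℂ] Qubit :=
    { toFun := fun v => !₂[a * v 0 + b * v 1, b * v 0 - a * v 1]
      map_add' := fun v w => by ext i; fin_cases i <;> simp <;> ring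
      map_smul' := fun t v => by ext i; fin_cases i <;> simp <;> ring }
  have hC : (a : ℂ) ^ 2 + (b : ℂ) ^ 2 = 1 := by exact_mod_cast h
  have hf : Function.Involutive f := fun v => by
    ext i
    fin_cases i
    · simp [f]; linear_combination v 0 * hC
    · simp [f]; linear_combination v 1 * hC
  have hs : ∀ v w, inner ℂ (f v) w = inner ℂ v (f w) := fun v w => by
    simp [f, PiLp.inner_apply]; ring
  { toUnitary :=
      { toLinearEquiv := LinearEquiv.ofInvolutive f hf
        norm_map' := fun v => by
          change ‖f v‖ = ‖v‖
          rw [@norm_eq_sqrt_re_inner ℂ, @norm_eq_sqrt_re_inner ℂ _ _ _ _ v, hs, hf] }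
    hermitian := hs }

theorem qubitObservable_ket_zero (a b : ℝ) (h : a ^ 2 + b ^ 2 = 1) :
    (qubitObservable a b h).op (ket 0) = (a : ℂ) • ket 0 + (b : ℂ) • ket 1 := by
  change !₂[(a : ℂ) * ket 0 0 + b * ket 0 1, (b : ℂ) * ket 0 0 - a * ket 0 1] = _
  ext i; fin_cases i <;> simp [ket]

theorem qubitObservable_ket_one (a b : ℝ) (h : a ^ 2 + b ^ 2 = 1) :
    (qubitObservable a b h).op (ket 1) = (b : ℂ) • ket 0 + (-a : ℂ) • ket 1 := by
  change !₂[(a : ℂ) * ket 1 0 + b * ket 1 1, (b : ℂ) * ket 1 0 - a * ket 1 1] = _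
  ext i; fin_cases i <;> simp [ket]

theorem inner_ket (i j : Fin 2) : inner ℂ (ket i) (ket j) = if i = j then (1 : ℂ) else 0 := by
  fin_cases i <;> fin_cases j <;> simp [ket, EuclideanSpace.inner_single_left]

/-- The two-qubit realization of the maximal value. -/
def idealRealization {α c s m n k l : ℝ} (p : IdealScalars α c s m n k l) :
    BellRealization Qubit Qubit where
  state := (c : ℂ) • elemTensor (ket 0) (ket 0) + (s : ℂ) • elemTensor (ket 1) (ket 1)
  norm_state := by
    have h : ‖(c : ℂ) • elemTensor (ket 0) (ket 0) + (s : ℂ) • elemTensor (ket 1) (ket 1)‖ ^ 2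
        = 1 := by
      rw [@norm_sq_eq_re_inner ℂ]
      simp only [inner_add_left, inner_add_right, inner_smul_left, inner_smul_right,
        inner_elemTensor, inner_ket]
      simp
      linear_combination p.cs
    exact (pow_eq_one_iff_of_nonneg (norm_nonneg _) two_ne_zero).mp h
  A := ![qubitObservable 1 0 (by norm_num), qubitObservable 0 1 (by norm_num)]
  B := ![qubitObservable m n p.sq_add_sq, qubitObservable m (-n) (by rw [neg_sq, p.sq_add_sq])]

/-- The state is an eigenvector of αZ⊗1 + 2m Z⊗Z + 2n X⊗X with eigenvalue 4m. -/
theorem value_idealRealization {α c s m n k l : ℝ} (p : IdealScalars α c s m n k l) :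
    (idealRealization p).value α = maxValue α := by
  have h : bell α (fun x => ((idealRealization p).opA x).toLinearMap)
      (fun y => ((idealRealization p).opB y).toLinearMap) (idealRealization p).state =
        ((4 * m : ℝ) : ℂ) • (idealRealization p).state := by
    have hcs : (c : ℂ) ^ 2 + (s : ℂ) ^ 2 = 1 := by exact_mod_cast p.cs
    have hα : (α : ℂ) = 2 * m * ((c : ℂ) ^ 2 - (s : ℂ) ^ 2) := by exact_mod_cast p.hα
    have hn : (n : ℂ) = 2 * m * c * s := by exact_mod_cast p.hmn
    simp only [bell, BellRealization.opA_eq_liftLeft, BellRealization.opB_eq_liftRight]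
    simp only [idealRealization, Matrix.cons_val_zero, Matrix.cons_val_one,
      ContinuousLinearMap.coe_coe, map_add, map_sub, map_smul, liftLeft_elemTensor,
      liftRight_elemTensor, qubitObservable_ket_zero, qubitObservable_ket_one,
      elemTensor_add_left, elemTensor_add_right, elemTensor_smul_left, elemTensor_smul_right]
    push_cast
    rw [hα, hn]
    linear_combination (norm := module) (2 * m : ℂ) • hcs • ((c : ℂ) •
      elemTensor (ket 0) (ket 0) + (s : ℂ) • elemTensor (ket 1) (ket 1))
  change (inner ℂ (idealRealization p).state (bell α (fun x =>
    ((idealRealization p).opA x).toLinearMap) (fun y =>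
    ((idealRealization p).opB y).toLinearMap) (idealRealization p).state)).re = _
  rw [h, inner_smul_right, Complex.re_ofReal_mul, ← RCLike.re_to_complex, inner_self_eq_norm_sq,
    BellRealization.norm_state, p.maxValue_eq]
  ring

end Attainment

theorem exists_robust_self_test {α : ℝ} (hα0 : 0 ≤ α) (hα2 : α ≤ 2) :
    ∃ C : ℝ, ∀ (HA : Type u) (HB : Type v)
      [NormedAddCommGroup HA] [InnerProductSpace ℂ HA]
      [NormedAddCommGroup HB] [InnerProductSpace ℂ HB] [CompleteSpace HB]
      (R : BellRealization HA HB) (ε : ℝ), 0 ≤ ε → maxValue α - ε ^ 2 ≤ R.value α →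
      ∃ (ΦA : HA →ₗᵢ[ℂ] HA ⊗[ℂ] Qubit) (ΦB : HB →ₗᵢ[ℂ] HB ⊗[ℂ] Qubit)
        (junk : HilbertTensor HA HB), ‖junk‖ = 1 ∧
        ‖tensorIsometry ΦA ΦB R.state - junkTensor junk (entangledState (angle α))‖ ≤ C * ε := by
  rcases hα2.eq_or_lt with rfl | hα2
  -- At α = 2 the target is |00⟩: appending |0⟩ on each side gives it exactly, with the shared state
  -- as junk.
  · refine ⟨0, fun HA HB _ _ _ _ _ R ε _ _ =>
      ⟨appendKet HA 0, appendKet HB 0, R.state, R.norm_state, ?_⟩⟩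
    have h : angle 2 = 0 := by norm_num [angle]
    rw [junkTensor_entangledState, h]
    simp
  · obtain ⟨m, n, k, l, p⟩ := exists_idealScalars hα0 hα2.le
    have hn0 := p.n_pos hα0 hα2
    have hmn := p.sq_add_sq
    have ht : |m ^ 2 - n ^ 2| < 1 := by
      rw [abs_lt]
      constructor <;> nlinarith [p.m_pos]
    obtain ⟨C, hC⟩ := exists_uniform_bound.{u, v} p hn0 (1 - |m ^ 2 - n ^ 2|)⁻¹
    refine ⟨8 * C, fun HA HB _ _ _ _ _ R ε hε hval => ?_⟩
    obtain ⟨S, hS1, hS2, hSK⟩ := exists_resolvent R.B ht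
    push_cast at hS1 hS2
    obtain ⟨h01, h10, h⟩ := hC HA HB R ε hε hval S hSK hS1 _ fun i j => rfl
    obtain ⟨junk, hj, hle⟩ := exists_junk
      (u := tensorIsometry (krausIsometry _ (norm_krausA R.A))
        (krausIsometry _ (norm_krausB R.B hmn p.kl hS1 hS2)) R.state)
      (by rw [LinearIsometry.norm_map, R.norm_state]) R.norm_state _
      (tensorIsometry_krausIsometry _ _ _ _ _) h01 h10 h
    exact ⟨_, _, junk, hj, by rwa [mul_assoc]⟩

end TiltedCHSH

end

theorem mainTheorem1 (α : ℝ) (hα0 : 0 ≤ α) (hα2 : α ≤ 2) :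
    -- `√(8 + 2 α²)` is the maximal quantum value, and it is attained by two qubits
    (∀ (HA : Type u) (HB : Type v)
        [NormedAddCommGroup HA] [InnerProductSpace ℂ HA] [CompleteSpace HA]
        [NormedAddCommGroup HB] [InnerProductSpace ℂ HB] [CompleteSpace HB]
        (R : TiltedCHSH.BellRealization HA HB),
        R.value α ≤ TiltedCHSH.maxValue α) ∧
    (∃ R : TiltedCHSH.BellRealization TiltedCHSH.Qubit TiltedCHSH.Qubit,
        R.value α = TiltedCHSH.maxValue α) ∧
    -- self-testing at the maximal value
    (∀ (HA : Type u) (HB : Type v)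
        [NormedAddCommGroup HA] [InnerProductSpace ℂ HA] [CompleteSpace HA]
        [NormedAddCommGroup HB] [InnerProductSpace ℂ HB] [CompleteSpace HB]
        (R : TiltedCHSH.BellRealization HA HB),
        R.value α = TiltedCHSH.maxValue α →
        ∃ (ΦA : HA →ₗᵢ[ℂ] HA ⊗[ℂ] TiltedCHSH.Qubit) (ΦB : HB →ₗᵢ[ℂ] HB ⊗[ℂ] TiltedCHSH.Qubit)
          (junk : TiltedCHSH.HilbertTensor HA HB), ‖junk‖ = 1 ∧
          TiltedCHSH.tensorIsometry ΦA ΦB R.state =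
            TiltedCHSH.junkTensor junk (TiltedCHSH.entangledState (TiltedCHSH.angle α))) ∧
    -- robustness
    (∃ C : ℝ, ∀ (HA : Type u) (HB : Type v)
        [NormedAddCommGroup HA] [InnerProductSpace ℂ HA] [CompleteSpace HA]
        [NormedAddCommGroup HB] [InnerProductSpace ℂ HB] [CompleteSpace HB]
        (R : TiltedCHSH.BellRealization HA HB) (ε : ℝ), 0 ≤ ε →
        TiltedCHSH.maxValue α - ε ^ 2 ≤ R.value α →
        ∃ (ΦA : HA →ₗᵢ[ℂ] HA ⊗[ℂ] TiltedCHSH.Qubit) (ΦB : HB →ₗᵢ[ℂ] HB ⊗[ℂ] TiltedCHSH.Qubit)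
          (junk : TiltedCHSH.HilbertTensor HA HB), ‖junk‖ = 1 ∧
          ‖TiltedCHSH.tensorIsometry ΦA ΦB R.state -
            TiltedCHSH.junkTensor junk
              (TiltedCHSH.entangledState (TiltedCHSH.angle α))‖ ≤ C * ε) := by
  obtain ⟨C, hC⟩ := TiltedCHSH.exists_robust_self_test.{u, v} hα0 hα2
  refine ⟨fun HA HB _ _ _ _ _ _ R => R.value_le α, ?_, ?_, C,
    fun HA HB _ _ _ _ _ _ R => hC HA HB R⟩
  · obtain ⟨m, n, k, l, p⟩ := TiltedCHSH.exists_idealScalars hα0 hα2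
    exact ⟨TiltedCHSH.idealRealization p, TiltedCHSH.value_idealRealization p⟩
  · intro HA HB _ _ _ _ _ _ R hR
    -- Exact self-testing is robustness at ε = 0.
    obtain ⟨ΦA, ΦB, junk, hj, h⟩ := hC HA HB R 0 le_rfl (by simp [hR])
    rw [mul_zero, norm_le_zero_iff, sub_eq_zero] at h
    exact ⟨ΦA, ΦB, junk, hj, h⟩
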